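/- Let $X$ be a closed (compact, without boundary) smooth three-manifold with a contact metric structure $(\phi,\xi,\kappa,g)$ (for instance a quasi-regular K-contact structure): $\kappa\in\Omega^1(X)$ is a contact form with Reeb field $\xi$ (so $\kappa(\xi)=1$, $\iota_\xi d\kappa=0$), $H=\ker\kappa$, $\phi\in\mathrm{End}(TX)$ satisfies $\phi(\xi)=0$ and restricts to a complex structure on $H$, and $g=\kappa\otimes\kappa+d\kappa(\cdot,\phi\,\cdot)$ is a Riemannian metric. Orient $X$ by $\kappa\wedge d\kappa$, and let $\star$ be the Hodge star of $g$, normalized by $\star 1=\kappa\wedge d\kappa$. A form is horizontal if it is annihilated by $\iota_\xi$; $\Omega^\bullet(H)$ denotes the horizontal forms. Put $\star_H=\iota_\xi\circ\star$, let $d_H\omega$ be the horizontal part of $d\omega$ (the restriction of $d\omega$ to $H$), and for $A\in\Omega^1(H)$ let $$D^1A=(\mathcal L_\xi+d_H\star_H d_H)A,\qquad DA=\kappa\wedge D^1A .$$ For one-forms let $\langle\alpha,\beta\rangle=\int_X\alpha\wedge\star\beta$ be the $L^2$ inner product, and for $\alpha,\beta\in\Omega^1(H)$ let $\langle\alpha,\beta\rangle^1_\kappa=-\int_X\kappa\wedge(\alpha\wedge\star_H\beta)$.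 For $A\in\Omega^1(X)$ define $$S(A)=\int_X A\wedge dA-\int_X\frac{(\kappa\wedge dA)^2}{\kappa\wedge d\kappa},$$ where $\frac{(\kappa\wedge dA)^2}{\kappa\wedge d\kappa}:=f\,\kappa\wedge dA$ for the function $f$ with $\kappa\wedge dA=f\,\kappa\wedge d\kappa$. Then: 1. $S$ is shift-invariant: $S(A+\sigma\kappa)=S(A)$ for all $A\in\Omega^1(X)$ and $\sigma\in C^\infty(X)$. 2. For every $A\in\Omega^1(H)$, $$S(A)=\langle A,\star DA\rangle=\langle A,-\star_H D^1A\rangle^1_\kappa .$$ 3. $D$ is Rumin's contact operator: for every $A\in\Omega^1(H)$ there is exactly one $l(A)\in\Omega^1(X)$ that agrees with $A$ on $H$ and satisfies $\kappa\wedge d\,l(A)=0$, and $DA=d\,l(A)$. -/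

import Mathlib

open scoped Manifold ContDiff

noncomputable section

namespace ContactCS

/-- The model space of three-manifolds. -/
abbrev E3 : Type := EuclideanSpace ℝ (Fin 3)

/-- The standard frame of the model space. -/
def stdFrame (i : Fin 3) : E3 := EuclideanSpace.single i (1 : ℝ)

/-! ### Exterior algebra on one tangent space -/

section Pointwise

variable {V : Type*} [NormedAddCommGroup V] [NormedSpace ℝ V]

/-- The wedge product `α ∧ η` of a one-form with a `k`-form,
`(α ∧ η) (v₀, …, v_k) = ∑ i, (-1)^i α (v_i) η (v₀, …, v̂_i, …, v_k)`. -/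
def wedgeOne {k : ℕ} (α : V [⋀^Fin 1]→L[ℝ] ℝ) (η : V [⋀^Fin k]→L[ℝ] ℝ) :
    V [⋀^Fin (k + 1)]→L[ℝ] ℝ :=
  ContinuousAlternatingMap.alternatizeUncurryFin
    (((ContinuousAlternatingMap.ofSubsingleton ℝ V ℝ (0 : Fin 1)).symm α).smulRight η)

/-- The contraction `η (v₀, …, v_{k-1}, ·, …, ·)`. -/
def contract {m : ℕ} : (k : ℕ) → (Fin k → V) → V [⋀^Fin (m + k)]→L[ℝ] ℝ → V [⋀^Fin m]→L[ℝ] ℝ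
  | 0, _, η => η
  | k + 1, v, η => contract k (fun i => v i.succ) (η.curryLeft (v 0))

/-- `e` is an orthonormal basis for the bilinear form `g`. -/
def IsOrthonormalFrame (g : V → V → ℝ) (e : Module.Basis (Fin 3) ℝ V) : Prop :=
  ∀ i j, g (e i) (e j) = if i = j then 1 else 0

open Classical in
/-- The Hodge star `⋆ : Λ^k → Λ^m`, `m + k = 3`, of a three-dimensional Euclidean space with inner
product `g` and volume form `vol`:
`⋆β = (1/k!) ∑ β (e_{i₁}, …, e_{i_k}) vol (e_{i₁}, …, e_{i_k}, ·, …, ·)`, the sum being over all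
`k`-tuples of members of an orthonormal basis `e` (it does not depend on the basis). -/
def hodgeStar (g : V → V → ℝ) {k m : ℕ} (vol : V [⋀^Fin (m + k)]→L[ℝ] ℝ)
    (β : V [⋀^Fin k]→L[ℝ] ℝ) : V [⋀^Fin m]→L[ℝ] ℝ :=
  if h : ∃ e : Module.Basis (Fin 3) ℝ V, IsOrthonormalFrame g e then
    ((k.factorial : ℝ)⁻¹) • ∑ f : Fin k → Fin 3,
      β (fun a => h.choose (f a)) • contract k (fun a => h.choose (f a)) vol
  else 0

end Pointwise

/-! ### Differential forms on a three-manifold -/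

section Manifold

variable {X : Type*} [TopologicalSpace X] [ChartedSpace E3 X]

variable (X) in
/-- (Not necessarily smooth) differential `k`-forms. The tangent space `TangentSpace (𝓡 3) x` of
Mathlib is by definition the model space `E3`, for every point `x`. -/
abbrev DiffForm (k : ℕ) : Type _ := X → E3 [⋀^Fin k]→L[ℝ] ℝ

/-- Differential at `p` of the preferred chart around `x₀`. -/
def chartD (x₀ p : X) : E3 →L[ℝ] E3 :=
  mfderiv (𝓡 3) 𝓘(ℝ, E3) (extChartAt (𝓡 3) x₀) p

/-- Differential at `y` of the inverse of the preferred chart around `x₀`. -/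
def chartSymmD (x₀ : X) (y : E3) : E3 →L[ℝ] E3 :=
  mfderiv 𝓘(ℝ, E3) (𝓡 3) (extChartAt (𝓡 3) x₀).symm y

/-- Coordinate expression of a form in the chart around `x₀`: its pullback under the inverse
chart. -/
def formRep {k : ℕ} (η : DiffForm X k) (x₀ : X) (y : E3) : E3 [⋀^Fin k]→L[ℝ] ℝ :=
  (η ((extChartAt (𝓡 3) x₀).symm y)).compContinuousLinearMap (chartSymmD x₀ y)

/-- Coordinate expression of a vector field in the chart around `x₀`. -/
def fieldRep (w : X → E3) (x₀ : X) (y : E3) : E3 :=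
  chartD x₀ ((extChartAt (𝓡 3) x₀).symm y) (w ((extChartAt (𝓡 3) x₀).symm y))

/-- Coordinate expression of an endomorphism field of the tangent bundle in the chart around
`x₀`. -/
def endoRep (φ : X → E3 →L[ℝ] E3) (x₀ : X) (y : E3) : E3 →L[ℝ] E3 :=
  (chartD x₀ ((extChartAt (𝓡 3) x₀).symm y)).comp
    ((φ ((extChartAt (𝓡 3) x₀).symm y)).comp (chartSymmD x₀ y))

/-- A form is smooth if its coordinate expressions are. -/
def IsSmoothForm {k : ℕ} (η : DiffForm X k) : Prop :=
  ∀ x₀ : X, ContDiffOn ℝ ∞ (formRep η x₀) (extChartAt (𝓡 3) x₀).target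

/-- A vector field is smooth if its coordinate expressions are. -/
def IsSmoothField (w : X → E3) : Prop :=
  ∀ x₀ : X, ContDiffOn ℝ ∞ (fieldRep w x₀) (extChartAt (𝓡 3) x₀).target

/-- An endomorphism field is smooth if its coordinate expressions are. -/
def IsSmoothEndo (φ : X → E3 →L[ℝ] E3) : Prop :=
  ∀ x₀ : X, ContDiffOn ℝ ∞ (endoRep φ x₀) (extChartAt (𝓡 3) x₀).target

/-- The exterior derivative, computed at `x` in the chart around `x`. -/
def extD {k : ℕ} (η : DiffForm X k) : DiffForm X (k + 1) := fun x =>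
  (extDeriv (formRep η x) (extChartAt (𝓡 3) x x)).compContinuousLinearMap (chartD x x)

/-- The Lie derivative of a one-form along a vector field, computed at `x` in the chart around `x`:
`(L_w α)_i = w^j ∂_j α_i + α_j ∂_i w^j`. -/
def lieD (w : X → E3) (α : DiffForm X 1) : DiffForm X 1 := fun x =>
  (fderiv ℝ (formRep α x) (extChartAt (𝓡 3) x x) (fieldRep w x (extChartAt (𝓡 3) x x)) +
    (formRep α x (extChartAt (𝓡 3) x x)).compContinuousLinearMap
      (fderiv ℝ (fieldRep w x) (extChartAt (𝓡 3) x x))).compContinuousLinearMap (chartD x x)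

/-- Wedge product of a one-form with a form. -/
def wedge {k : ℕ} (α : DiffForm X 1) (η : DiffForm X k) : DiffForm X (k + 1) :=
  fun x => wedgeOne (α x) (η x)

/-- Product of a function with a form. -/
def smulForm {k : ℕ} (f : X → ℝ) (η : DiffForm X k) : DiffForm X k := fun x => f x • η x

/-- Interior product with a vector field. -/
def interior {k : ℕ} (w : X → E3) (η : DiffForm X (k + 1)) : DiffForm X k :=
  fun x => (η x).curryLeft (w x)

/-- The quotient `η / μ` of a three-form by a nowhere vanishing three-form: the function `f` with
`η = f μ`. -/
def quot (η μ : DiffForm X 3) (x : X) : ℝ := η x stdFrame / μ x stdFrame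

/-! ### Integration -/

section Integration

variable [IsManifold (𝓡 3) ∞ X] [CompactSpace X] [T2Space X]

variable (X) in
/-- A smooth partition of unity subordinate to the cover by the domains of the preferred charts. -/
def partUnity : SmoothPartitionOfUnity X (𝓡 3) X Set.univ :=
  (SmoothPartitionOfUnity.exists_isSubordinate_chartAt_source (I := 𝓡 3) X).choose

variable (X) in
theorem partUnity_isSubordinate :
    (partUnity X).IsSubordinate (fun x => (chartAt E3 x).source) :=
  (SmoothPartitionOfUnity.exists_isSubordinate_chartAt_source (I := 𝓡 3) X).choose_spec

/-- The integral of the three-form `η` over the closed manifold `X`, oriented by the nowhere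
vanishing three-form `μ`: cut `η` with a partition of unity and integrate the pieces in the charts,
with a sign that compares the orientation of the chart with that given by `μ`. -/
def integral (μ η : DiffForm X 3) : ℝ :=
  ∑ᶠ i : X, ∫ y in (extChartAt (𝓡 3) i).target,
    Real.sign (formRep μ i y stdFrame) *
      (partUnity X i ((extChartAt (𝓡 3) i).symm y) * formRep η i y stdFrame)

end Integration

/-! ### Contact metric structures -/

variable (X) in
/-- A contact metric structure `(φ, ξ, κ, g)` on a three-manifold: `κ` is a contact form, `ξ` its
Reeb field, `φ` vanishes on `ξ` and is a complex structure on `H = ker κ`, and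
`g = κ ⊗ κ + dκ(·, φ ·)` is a Riemannian metric. -/
structure ContactMetricStructure where
  κ : DiffForm X 1
  ξ : X → E3
  φ : X → E3 →L[ℝ] E3
  smooth_κ : IsSmoothForm κ
  smooth_ξ : IsSmoothField ξ
  smooth_φ : IsSmoothEndo φ
  contact : ∀ x, wedge κ (extD κ) x ≠ 0
  κ_ξ : ∀ x, κ x ![ξ x] = 1
  dκ_ξ : ∀ x (v : E3), extD κ x ![ξ x, v] = 0
  φ_ξ : ∀ x, φ x (ξ x) = 0
  φ_horizontal : ∀ x (v : E3), κ x ![v] = 0 → κ x ![φ x v] = 0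
  φ_sq : ∀ x (v : E3), κ x ![v] = 0 → φ x (φ x v) = -v
  metric_symm : ∀ x (u v : E3),
    κ x ![u] * κ x ![v] + extD κ x ![u, φ x v] = κ x ![v] * κ x ![u] + extD κ x ![v, φ x u]
  metric_pos : ∀ x (v : E3), v ≠ 0 → 0 < κ x ![v] * κ x ![v] + extD κ x ![v, φ x v]

namespace ContactMetricStructure

variable (M : ContactMetricStructure X)

/-- The metric `g = κ ⊗ κ + dκ(·, φ ·)`. -/
def g (x : X) (u v : E3) : ℝ := M.κ x ![u] * M.κ x ![v] + extD M.κ x ![u, M.φ x v]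

/-- The volume form `κ ∧ dκ`, which also orients the manifold. -/
def vol : DiffForm X 3 := wedge M.κ (extD M.κ)

/-- The form lies in `Ω^1(H)`, that is, `ι_ξ A = 0`. -/
def IsHorizontal (A : DiffForm X 1) : Prop := ∀ x, A x ![M.ξ x] = 0

/-- The projection of the tangent space onto `H = ker κ` along `ξ`. -/
def projH (x : X) : E3 →L[ℝ] E3 :=
  ContinuousLinearMap.id ℝ E3 -
    ((ContinuousAlternatingMap.ofSubsingleton ℝ E3 ℝ (0 : Fin 1)).symm (M.κ x)).smulRight (M.ξ x)

/-- The horizontal exterior derivative: the restriction of `dη` to `H`, regarded as a horizontal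
form. -/
def dH {k : ℕ} (η : DiffForm X k) : DiffForm X (k + 1) :=
  fun x => (extD η x).compContinuousLinearMap (M.projH x)

/-- The Hodge star of `g` on one-forms, normalized by `⋆1 = κ ∧ dκ`. -/
def star₁ (β : DiffForm X 1) : DiffForm X 2 :=
  fun x => hodgeStar (M.g x) (k := 1) (m := 2) (M.vol x) (β x)

/-- The Hodge star of `g` on two-forms, normalized by `⋆1 = κ ∧ dκ`. -/
def star₂ (β : DiffForm X 2) : DiffForm X 1 :=
  fun x => hodgeStar (M.g x) (k := 2) (m := 1) (M.vol x) (β x)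

/-- The horizontal star `⋆_H = ι_ξ ∘ ⋆` on one-forms. -/
def starH₁ (β : DiffForm X 1) : DiffForm X 1 := interior M.ξ (M.star₁ β)

/-- The horizontal star `⋆_H = ι_ξ ∘ ⋆` on two-forms. -/
def starH₂ (β : DiffForm X 2) : DiffForm X 0 := interior M.ξ (M.star₂ β)

/-- `D¹ = L_ξ + d_H ⋆_H d_H` on one-forms. -/
def D1 (A : DiffForm X 1) : DiffForm X 1 := lieD M.ξ A + M.dH (M.starH₂ (M.dH A))

/-- The contact operator `D = κ ∧ (L_ξ + d_H ⋆_H d_H)`. -/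
def D (A : DiffForm X 1) : DiffForm X 2 := wedge M.κ (M.D1 A)

/-- `l` is a smooth one-form that agrees with `A` on `H` and whose differential is vertical:
`κ ∧ dl = 0`. -/
def IsRuminLift (A l : DiffForm X 1) : Prop :=
  IsSmoothForm l ∧ (∀ x (v : E3), M.κ x ![v] = 0 → l x ![v] = A x ![v]) ∧
    wedge M.κ (extD l) = 0

section Integrals

variable [IsManifold (𝓡 3) ∞ X] [CompactSpace X] [T2Space X]

/-- The action `S(A) = ∫ A ∧ dA - ∫ (κ ∧ dA)² / (κ ∧ dκ)`, where `(κ ∧ dA)² / (κ ∧ dκ)` is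
`f (κ ∧ dA)` for the function `f` with `κ ∧ dA = f (κ ∧ dκ)`. -/
def action (A : DiffForm X 1) : ℝ :=
  integral M.vol (wedge A (extD A)) -
    integral M.vol (smulForm (quot (wedge M.κ (extD A)) (wedge M.κ (extD M.κ)))
      (wedge M.κ (extD A)))

/-- The `L²` inner product `⟨α, β⟩ = ∫ α ∧ ⋆β` on one-forms. -/
def inner (α β : DiffForm X 1) : ℝ := integral M.vol (wedge α (M.star₁ β))

/-- The pairing `⟨α, β⟩_κ = -∫ κ ∧ (α ∧ ⋆_H β)` on horizontal one-forms. -/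
def innerκ (α β : DiffForm X 1) : ℝ := -integral M.vol (wedge M.κ (wedge α (M.starH₁ β)))

end Integrals

end ContactMetricStructure

end Manifold

end ContactCS

end

/-!
Write `κ ∧ dA = f κ ∧ dκ` and `l(A) = A - f κ`. Replacing `A` by `A + σ κ` replaces `f` by `f + σ`,
since `κ ∧ dσ ∧ κ = 0`; hence `l(A)` depends only on `A` restricted to `H`, it satisfies
`κ ∧ dl(A) = 0`, and it is the only such extension of that restriction. By definition
`S(A) = ∫ l(A) ∧ dA`, and Stokes' theorem in the form `∫ α ∧ dβ = ∫ β ∧ dα` turns this into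
`S(A) = ∫ A ∧ dl(A)`. As `κ ∧ dl(A) = 0`, this gives shift invariance.

For horizontal `A`, Cartan's formula gives `L_ξ A = ι_ξ dA`, and `d_H A = f dκ = ι_{f ξ} (κ ∧ dκ)`
gives `⋆_H d_H A = f`. Hence `DA = κ ∧ ι_ξ dA + κ ∧ df = dA - f dκ - df ∧ κ = dl(A)`. Finally
`⋆ ⋆ (κ ∧ B) = κ ∧ B` and `⋆_H ⋆_H B = -B` for horizontal `B` identify `∫ A ∧ DA` with both
pairings.

Every star is read off from `⋆ g(w, ·) = ι_w vol` and `⋆ ι_w vol = g(w, ·)`. Stokes' theorem is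
reduced by a partition of unity to Euclidean space, where it is the vanishing of the integral of a
derivative of a compactly supported function.
-/

noncomputable section

namespace ContactCS

/-! ### Exterior algebra -/

section Pointwise

variable {V W : Type*} [NormedAddCommGroup V] [NormedSpace ℝ V] [NormedAddCommGroup W]
  [NormedSpace ℝ W]

theorem ofSubsingleton_symm_apply (α : V [⋀^Fin 1]→L[ℝ] ℝ) (v : V) :
    (ContinuousAlternatingMap.ofSubsingleton ℝ V ℝ (0 : Fin 1)).symm α v = α ![v] :=
  congrArg α (funext fun i => by simp [Subsingleton.elim i 0])

theorem oneForm_ext {α β : V [⋀^Fin 1]→L[ℝ] ℝ} (h : ∀ v, α ![v] = β ![v]) : α = β := by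
  ext v
  have hv : v = ![v 0] := List.ofFn_inj.1 rfl
  rw [hv]
  exact h _

theorem oneForm_compContinuousLinearMap_apply (α : V [⋀^Fin 1]→L[ℝ] ℝ) (L : W →L[ℝ] V) (w : W) :
    α.compContinuousLinearMap L ![w] = α ![L w] :=
  congrArg α (List.ofFn_inj.1 rfl)

theorem form_ext_curryLeft {k : ℕ} {η θ : V [⋀^Fin (k + 1)]→L[ℝ] ℝ}
    (h : ∀ v, η.curryLeft v = θ.curryLeft v) : η = θ :=
  ContinuousAlternatingMap.curryLeftLI.injective (ContinuousLinearMap.ext h)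

theorem wedgeOne_apply {k : ℕ} (α : V [⋀^Fin 1]→L[ℝ] ℝ) (η : V [⋀^Fin k]→L[ℝ] ℝ)
    (v : Fin (k + 1) → V) :
    wedgeOne α η v = ∑ i : Fin (k + 1), (-1) ^ (i : ℕ) * (α ![v i] * η (i.removeNth v)) := by
  rw [wedgeOne, ContinuousAlternatingMap.alternatizeUncurryFin_apply]
  refine Finset.sum_congr rfl fun i _ => ?_
  rw [ContinuousLinearMap.smulRight_apply, ofSubsingleton_symm_apply]
  simp

theorem removeNth_succ_vecCons {α : Type*} {k : ℕ} (i : Fin (k + 1)) (a : α)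
    (v : Fin (k + 1) → α) :
    i.succ.removeNth (Matrix.vecCons a v) = Matrix.vecCons a (i.removeNth v) := by
  ext j
  cases j using Fin.cases <;> simp [Fin.removeNth_apply]

theorem wedgeOne_apply_two (α β : V [⋀^Fin 1]→L[ℝ] ℝ) (u v : V) :
    wedgeOne α β ![u, v] = α ![u] * β ![v] - α ![v] * β ![u] := by
  simp [wedgeOne_apply, Fin.sum_univ_succ, removeNth_succ_vecCons, -Fin.succ_zero_eq_one,
    sub_eq_add_neg]

theorem wedgeOne_apply_three (α : V [⋀^Fin 1]→L[ℝ] ℝ) (η : V [⋀^Fin 2]→L[ℝ] ℝ) (u v w : V) :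
    wedgeOne α η ![u, v, w] =
      α ![u] * η ![v, w] - α ![v] * η ![u, w] + α ![w] * η ![u, v] := by
  simp [wedgeOne_apply, Fin.sum_univ_succ, removeNth_succ_vecCons, -Fin.succ_zero_eq_one,
    sub_eq_add_neg, add_assoc]

theorem wedgeOne_compContinuousLinearMap {k : ℕ} (α : V [⋀^Fin 1]→L[ℝ] ℝ)
    (η : V [⋀^Fin k]→L[ℝ] ℝ) (L : W →L[ℝ] V) :
    (wedgeOne α η).compContinuousLinearMap L =
      wedgeOne (α.compContinuousLinearMap L) (η.compContinuousLinearMap L) := by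
  ext v
  simp only [ContinuousAlternatingMap.compContinuousLinearMap_apply, wedgeOne_apply]
  refine Finset.sum_congr rfl fun i _ => ?_
  congr 3
  ext j
  simp

variable (V) in
/-- The wedge product of one-forms with `k`-forms as a continuous bilinear map, from which the
linearity and the calculus of `wedgeOne` are inherited. -/
def wedgeOneCLM (k : ℕ) :
    (V [⋀^Fin 1]→L[ℝ] ℝ) →L[ℝ] (V [⋀^Fin k]→L[ℝ] ℝ) →L[ℝ] (V [⋀^Fin (k + 1)]→L[ℝ] ℝ) :=
  (ContinuousLinearMap.compL ℝ _ _ _ (ContinuousAlternatingMap.alternatizeUncurryFinCLM ℝ V ℝ) ∘L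
      ContinuousLinearMap.smulRightL ℝ V (V [⋀^Fin k]→L[ℝ] ℝ)) ∘L
    ((ContinuousAlternatingMap.ofSubsingletonLIE (𝕜 := ℝ) (E := V) (F := ℝ)
      (0 : Fin 1)).symm : (V [⋀^Fin 1]→L[ℝ] ℝ) →L[ℝ] (V →L[ℝ] ℝ))

theorem wedgeOne_add_left {k : ℕ} (α β : V [⋀^Fin 1]→L[ℝ] ℝ) (η : V [⋀^Fin k]→L[ℝ] ℝ) :
    wedgeOne (α + β) η = wedgeOne α η + wedgeOne β η :=
  (wedgeOneCLM V k).map_add₂ α β η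

theorem wedgeOne_add_right {k : ℕ} (α : V [⋀^Fin 1]→L[ℝ] ℝ) (η θ : V [⋀^Fin k]→L[ℝ] ℝ) :
    wedgeOne α (η + θ) = wedgeOne α η + wedgeOne α θ :=
  map_add (wedgeOneCLM V k α) η θ

theorem wedgeOne_zero_right {k : ℕ} (α : V [⋀^Fin 1]→L[ℝ] ℝ) :
    wedgeOne α (0 : V [⋀^Fin k]→L[ℝ] ℝ) = 0 :=
  map_zero (wedgeOneCLM V k α)

theorem wedgeOne_neg_right {k : ℕ} (α : V [⋀^Fin 1]→L[ℝ] ℝ) (η : V [⋀^Fin k]→L[ℝ] ℝ) :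
    wedgeOne α (-η) = -wedgeOne α η :=
  map_neg (wedgeOneCLM V k α) η

theorem wedgeOne_sub_right {k : ℕ} (α : V [⋀^Fin 1]→L[ℝ] ℝ) (η θ : V [⋀^Fin k]→L[ℝ] ℝ) :
    wedgeOne α (η - θ) = wedgeOne α η - wedgeOne α θ :=
  map_sub (wedgeOneCLM V k α) η θ

theorem wedgeOne_smul_left {k : ℕ} (c : ℝ) (α : V [⋀^Fin 1]→L[ℝ] ℝ) (η : V [⋀^Fin k]→L[ℝ] ℝ) :
    wedgeOne (c • α) η = c • wedgeOne α η :=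
  (wedgeOneCLM V k).map_smul₂ c α η

theorem wedgeOne_smul_right {k : ℕ} (c : ℝ) (α : V [⋀^Fin 1]→L[ℝ] ℝ) (η : V [⋀^Fin k]→L[ℝ] ℝ) :
    wedgeOne α (c • η) = c • wedgeOne α η :=
  map_smul (wedgeOneCLM V k α) c η

theorem wedgeOne_wedgeOne_self {k : ℕ} (α : V [⋀^Fin 1]→L[ℝ] ℝ) (η : V [⋀^Fin k]→L[ℝ] ℝ) :
    wedgeOne α (wedgeOne α η) = 0 := by
  set a := (ContinuousAlternatingMap.ofSubsingleton ℝ V ℝ (0 : Fin 1)).symm α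
  have h : a.smulRight (wedgeOne α η) =
      ContinuousAlternatingMap.alternatizeUncurryFinCLM ℝ V ℝ ∘L a.smulRight (a.smulRight η) := by
    ext v : 1
    exact (map_smul (ContinuousAlternatingMap.alternatizeUncurryFinCLM ℝ V ℝ) (a v) _).symm
  rw [wedgeOne, h]
  refine ContinuousAlternatingMap.alternatizeUncurryFin_alternatizeUncurryFinCLM_comp_of_symmetric
    fun u v => ?_
  simp only [ContinuousLinearMap.smulRight_apply, smul_apply, smul_comm (a u)]

theorem wedgeOne_left_anticomm {k : ℕ} (α β : V [⋀^Fin 1]→L[ℝ] ℝ) (η : V [⋀^Fin k]→L[ℝ] ℝ) :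
    wedgeOne α (wedgeOne β η) = -wedgeOne β (wedgeOne α η) := by
  have h := wedgeOne_wedgeOne_self (α + β) η
  simp only [wedgeOne_add_left, wedgeOne_add_right, wedgeOne_wedgeOne_self, zero_add,
    add_zero] at h
  exact eq_neg_of_add_eq_zero_right h

theorem curryLeft_wedgeOne {k : ℕ} (α : V [⋀^Fin 1]→L[ℝ] ℝ) (η : V [⋀^Fin (k + 1)]→L[ℝ] ℝ)
    (w : V) :
    (wedgeOne α η).curryLeft w = α ![w] • η - wedgeOne α (η.curryLeft w) := by
  ext v
  simp [wedgeOne_apply, Fin.sum_univ_succ (n := k + 1), removeNth_succ_vecCons, pow_succ,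
    sub_eq_add_neg]

theorem wedgeOne_comm (α β : V [⋀^Fin 1]→L[ℝ] ℝ) : wedgeOne α β = -wedgeOne β α := by
  refine form_ext_curryLeft fun u => oneForm_ext fun v => ?_
  simp [wedgeOne_apply_two, mul_comm]

theorem wedgeOne_self (α : V [⋀^Fin 1]→L[ℝ] ℝ) : wedgeOne α α = 0 := by
  refine form_ext_curryLeft fun u => oneForm_ext fun v => ?_
  simp [wedgeOne_apply_two, mul_comm]

theorem curryLeft_curryLeft_comm {k : ℕ} (η : V [⋀^Fin (k + 2)]→L[ℝ] ℝ) (u v : V) :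
    (η.curryLeft u).curryLeft v = -(η.curryLeft v).curryLeft u := by
  have h := η.curryLeft_same (u + v)
  simp only [map_add, ContinuousAlternatingMap.curryLeft_add, add_apply,
    ContinuousAlternatingMap.curryLeft_same, zero_add, add_zero] at h
  exact eq_neg_of_add_eq_zero_right h

/-- The projection of the tangent space onto the kernel of the one-form `κ` along the vector `w`,
when `κ (w) = 1`. -/
def kernelProj (κ : V [⋀^Fin 1]→L[ℝ] ℝ) (w : V) : V →L[ℝ] V :=
  ContinuousLinearMap.id ℝ V -
    ((ContinuousAlternatingMap.ofSubsingleton ℝ V ℝ (0 : Fin 1)).symm κ).smulRight w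

theorem kernelProj_apply (κ : V [⋀^Fin 1]→L[ℝ] ℝ) (w v : V) :
    kernelProj κ w v = v - κ ![v] • w := by
  rw [← ofSubsingleton_symm_apply κ v]
  rfl

theorem compContinuousLinearMap_kernelProj {κ : V [⋀^Fin 1]→L[ℝ] ℝ} {w : V} (h : κ ![w] = 1) :
    ∀ {k : ℕ} (η : V [⋀^Fin (k + 1)]→L[ℝ] ℝ),
      η.compContinuousLinearMap (kernelProj κ w) = η - wedgeOne κ (η.curryLeft w)
  | 0, η => oneForm_ext fun v => by
    have hη (u : V) : η ![u] = η.curryLeft u ![] := rfl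
    simp [-ContinuousAlternatingMap.compContinuousLinearMap_apply,
      oneForm_compContinuousLinearMap_apply, kernelProj_apply, wedgeOne_apply, hη,
      -ContinuousAlternatingMap.curryLeft_apply_apply]
  | k + 1, η => form_ext_curryLeft fun v => by
    have hw : (η.curryLeft (kernelProj κ w v)).curryLeft w = -(η.curryLeft w).curryLeft v := by
      rw [kernelProj_apply, map_sub, map_smul, ← curryLeft_curryLeft_comm]
      change (η.curryLeft v).curryLeft w - κ ![v] • (η.curryLeft w).curryLeft w = _
      rw [η.curryLeft_same, smul_zero, sub_zero]
    rw [ContinuousAlternatingMap.curryLeft_compContinuousLinearMap,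
      compContinuousLinearMap_kernelProj h, hw, wedgeOne_neg_right]
    change _ = η.curryLeft v - (wedgeOne κ (η.curryLeft w)).curryLeft v
    rw [curryLeft_wedgeOne, kernelProj_apply, map_sub, map_smul]
    abel

theorem wedgeOne_compContinuousLinearMap_kernelProj {k : ℕ} {κ : V [⋀^Fin 1]→L[ℝ] ℝ} {w : V}
    (h : κ ![w] = 1) (η : V [⋀^Fin (k + 1)]→L[ℝ] ℝ) :
    wedgeOne κ (η.compContinuousLinearMap (kernelProj κ w)) = wedgeOne κ η := by
  rw [compContinuousLinearMap_kernelProj h, wedgeOne_sub_right, wedgeOne_wedgeOne_self,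
    sub_zero]

theorem contDiffOn_wedgeOne {k : ℕ} {n : ℕ∞ω} {s : Set W} {α : W → V [⋀^Fin 1]→L[ℝ] ℝ}
    {η : W → V [⋀^Fin k]→L[ℝ] ℝ} (hα : ContDiffOn ℝ n α s) (hη : ContDiffOn ℝ n η s) :
    ContDiffOn ℝ n (fun y => wedgeOne (α y) (η y)) s :=
  (wedgeOneCLM V k).isBoundedBilinearMap.contDiff.comp_contDiffOn (hα.prodMk hη)

theorem fderiv_wedgeOne_apply {k : ℕ} {α : W → V [⋀^Fin 1]→L[ℝ] ℝ} {η : W → V [⋀^Fin k]→L[ℝ] ℝ}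
    {x : W} (hα : DifferentiableAt ℝ α x) (hη : DifferentiableAt ℝ η x) (u : W) :
    fderiv ℝ (fun y => wedgeOne (α y) (η y)) x u =
      wedgeOne (α x) (fderiv ℝ η x u) + wedgeOne (fderiv ℝ α x u) (η x) :=
  congrArg (fun L => L u) ((wedgeOneCLM V k).fderiv_of_bilinear hα hη)

end Pointwise

/-! ### Calculus and top forms on normed spaces -/

section Calculus

variable {V : Type*} [NormedAddCommGroup V] [NormedSpace ℝ V]

theorem extDeriv_apply_two {α : V → V [⋀^Fin 1]→L[ℝ] ℝ} {x : V} (h : DifferentiableAt ℝ α x)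
    (u v : V) :
    extDeriv α x ![u, v] = fderiv ℝ α x u ![v] - fderiv ℝ α x v ![u] := by
  have h₁ : (1 : Fin 2).removeNth ![u, v] = ![u] := removeNth_succ_vecCons 0 u ![v]
  simp [extDeriv_apply h, fderiv_continuousAlternatingMap_apply_const_apply h, Fin.sum_univ_two,
    sub_eq_add_neg, h₁]

theorem extDeriv_apply_three {η : V → V [⋀^Fin 2]→L[ℝ] ℝ} {x : V} (h : DifferentiableAt ℝ η x)
    (u v w : V) :
    extDeriv η x ![u, v, w] =
      fderiv ℝ η x u ![v, w] - fderiv ℝ η x v ![u, w] + fderiv ℝ η x w ![u, v] := by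
  simp [extDeriv_apply h, fderiv_continuousAlternatingMap_apply_const_apply h,
    Fin.sum_univ_succ, removeNth_succ_vecCons, -Fin.succ_zero_eq_one, sub_eq_add_neg, add_assoc]

theorem extDeriv_fun_zero {k : ℕ} (x : V) :
    extDeriv (fun _ : V => (0 : V [⋀^Fin k]→L[ℝ] ℝ)) x = 0 := by
  rw [extDeriv, fderiv_fun_const]
  exact map_zero (ContinuousAlternatingMap.alternatizeUncurryFinCLM ℝ V ℝ)

theorem fderiv_oneForm_apply {α : V → V [⋀^Fin 1]→L[ℝ] ℝ} {w : V → V} {x : V}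
    (hα : DifferentiableAt ℝ α x) (hw : DifferentiableAt ℝ w x) (u : V) :
    fderiv ℝ (fun y => α y ![w y]) x u = fderiv ℝ α x u ![w x] + α x ![fderiv ℝ w x u] := by
  set e := (ContinuousAlternatingMap.ofSubsingletonLIE (𝕜 := ℝ) (E := V) (F := ℝ)
    (0 : Fin 1)).symm.toContinuousLinearEquiv.toContinuousLinearMap
  have h := ((e.hasFDerivAt.comp x hα.hasFDerivAt).clm_apply hw.hasFDerivAt).fderiv
  simp only [← ofSubsingleton_symm_apply]
  exact (congrArg (fun L => L u) h).trans (add_comm _ _)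

theorem extDeriv_fun_mul {k : ℕ} {f : V → ℝ} {η : V → V [⋀^Fin k]→L[ℝ] ℝ} {x : V}
    (hf : DifferentiableAt ℝ f x) (hη : DifferentiableAt ℝ η x) :
    extDeriv (fun y => f y • η y) x =
      wedgeOne (ContinuousAlternatingMap.ofSubsingleton ℝ V ℝ (0 : Fin 1) (fderiv ℝ f x)) (η x) +
        f x • extDeriv η x := by
  rw [extDeriv, fderiv_fun_smul hf hη, ContinuousAlternatingMap.alternatizeUncurryFin_add,
    ContinuousAlternatingMap.alternatizeUncurryFin_smul, wedgeOne,
    Equiv.symm_apply_apply, extDeriv]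
  exact add_comm _ _

theorem extDeriv_wedgeOne {α β : V → V [⋀^Fin 1]→L[ℝ] ℝ} {x : V}
    (hα : DifferentiableAt ℝ α x) (hβ : DifferentiableAt ℝ β x) :
    extDeriv (fun y => wedgeOne (α y) (β y)) x =
      wedgeOne (β x) (extDeriv α x) - wedgeOne (α x) (extDeriv β x) := by
  refine form_ext_curryLeft fun u => form_ext_curryLeft fun v => oneForm_ext fun w => ?_
  have hw : DifferentiableAt ℝ (fun y => wedgeOne (α y) (β y)) x :=
    ((wedgeOneCLM V 1).hasFDerivAt_of_bilinear hα.hasFDerivAt hβ.hasFDerivAt).differentiableAt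
  change extDeriv _ x ![u, v, w] = wedgeOne _ _ ![u, v, w] - wedgeOne _ _ ![u, v, w]
  rw [extDeriv_apply_three hw]
  simp only [fderiv_wedgeOne_apply hα hβ, ContinuousAlternatingMap.add_apply,
    wedgeOne_apply_two, wedgeOne_apply_three, extDeriv_apply_two hα, extDeriv_apply_two hβ]
  ring

end Calculus

section TopForms

variable {V : Type*} [NormedAddCommGroup V] [NormedSpace ℝ V]
variable {n : ℕ} (b : Module.Basis (Fin n) ℝ V)

theorem topForm_eq_smul_det (η : V [⋀^Fin n]→L[ℝ] ℝ) (v : Fin n → V) : η v = η b * b.det v :=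
  congrArg (fun f => f v) (AlternatingMap.eq_smul_basis_det b η.toAlternatingMap)

theorem topForm_eq_zero {η : V [⋀^Fin n]→L[ℝ] ℝ} (h : η b = 0) : η = 0 := by
  ext v
  simp [topForm_eq_smul_det b η v, h]

theorem topForm_comp_apply (η : V [⋀^Fin n]→L[ℝ] ℝ) (L : V →L[ℝ] V) :
    η.compContinuousLinearMap L b = L.det * η b := by
  rw [ContinuousAlternatingMap.compContinuousLinearMap_apply, topForm_eq_smul_det b, mul_comm]
  congr 1
  simpa [b.det_self] using b.det_comp (L : V →ₗ[ℝ] V) b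

end TopForms

section EuclideanStokes

open MeasureTheory

variable {V : Type*} [NormedAddCommGroup V] [NormedSpace ℝ V] [MeasurableSpace V] [BorelSpace V]
  (μ : Measure V)

theorem integrable_fderiv_apply [IsFiniteMeasureOnCompacts μ] {f : V → ℝ} (hf : ContDiff ℝ 1 f)
    (hc : HasCompactSupport f) (v : V) : Integrable (fun y => fderiv ℝ f y v) μ :=
  ((hf.continuous_fderiv (by simp)).clm_apply continuous_const).integrable_of_hasCompactSupport
    (hc.fderiv_apply ℝ v)

variable [FiniteDimensional ℝ V] [μ.IsAddHaarMeasure]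

theorem integral_fderiv_apply_eq_zero {f : V → ℝ} (hf : ContDiff ℝ 1 f) (hc : HasCompactSupport f)
    (v : V) : ∫ y, fderiv ℝ f y v ∂μ = 0 := by
  simpa using integral_mul_fderiv_eq_neg_fderiv_mul_of_integrable (μ := μ) (𝕜 := ℝ)
    (f := fun _ : V => (1 : ℝ)) (g := f) (v := v) (by simp)
    (by simpa using integrable_fderiv_apply μ hf hc v)
    (by simpa using hf.continuous.integrable_of_hasCompactSupport hc)
    (fun _ _ => differentiableAt_const _) (fun _ _ => hf.differentiable (by simp) _)

theorem integral_extDeriv_apply_eq_zero {k : ℕ} {η : V → V [⋀^Fin k]→L[ℝ] ℝ} (hη : ContDiff ℝ 1 η)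
    (hc : HasCompactSupport η) (v : Fin (k + 1) → V) : ∫ y, extDeriv η y v ∂μ = 0 := by
  have hd (u : Fin k → V) : ContDiff ℝ 1 (fun y => η y u) :=
    (ContinuousAlternatingMap.apply ℝ V ℝ u).contDiff.comp hη
  have hcu (u : Fin k → V) : HasCompactSupport (fun y => η y u) :=
    hc.comp_left (g := fun θ : V [⋀^Fin k]→L[ℝ] ℝ => θ u) rfl
  simp only [extDeriv_apply (hη.differentiable (by simp) _), zsmul_eq_mul]
  rw [integral_finsetSum _ fun i _ => (integrable_fderiv_apply μ (hd _) (hcu _) _).const_mul _]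
  simp only [integral_const_mul, integral_fderiv_apply_eq_zero μ (hd _) (hcu _), mul_zero,
    Finset.sum_const_zero]

end EuclideanStokes

/-! ### Differential forms on manifolds -/

section Charts

variable {X : Type*} [TopologicalSpace X] [ChartedSpace E3 X] {k : ℕ}

theorem IsSmoothForm.differentiableAt {η : DiffForm X k} (hη : IsSmoothForm η) {i : X} {y : E3}
    (hy : y ∈ (extChartAt (𝓡 3) i).target) : DifferentiableAt ℝ (formRep η i) y :=
  ((hη i).contDiffAt ((isOpen_extChartAt_target i).mem_nhds hy)).differentiableAt (by simp)

theorem formRep_zero (i : X) : formRep (0 : DiffForm X k) i = 0 := rfl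

theorem formRep_add (η θ : DiffForm X k) (i : X) :
    formRep (η + θ) i = formRep η i + formRep θ i := rfl

theorem formRep_smulForm (σ : X → ℝ) (η : DiffForm X k) (i : X) :
    formRep (smulForm σ η) i = fun y => σ ((extChartAt (𝓡 3) i).symm y) • formRep η i y := rfl

theorem formRep_wedge (α : DiffForm X 1) (η : DiffForm X k) (i : X) :
    formRep (wedge α η) i = fun y => wedgeOne (formRep α i y) (formRep η i y) :=
  funext fun _ => wedgeOne_compContinuousLinearMap _ _ _

theorem isSmoothForm_zero : IsSmoothForm (0 : DiffForm X k) := fun i => by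
  rw [formRep_zero]
  exact contDiffOn_const

theorem IsSmoothForm.add {η θ : DiffForm X k} (hη : IsSmoothForm η) (hθ : IsSmoothForm θ) :
    IsSmoothForm (η + θ) := fun i => by
  rw [formRep_add]
  exact (hη i).add (hθ i)

theorem IsSmoothForm.wedge {α : DiffForm X 1} {η : DiffForm X k} (hα : IsSmoothForm α)
    (hη : IsSmoothForm η) : IsSmoothForm (wedge α η) := fun i => by
  rw [formRep_wedge]
  exact contDiffOn_wedgeOne (hα i) (hη i)

theorem IsSmoothForm.sum {ι : Type*} {s : Finset ι} {f : ι → DiffForm X k}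
    (hf : ∀ i ∈ s, IsSmoothForm (f i)) : IsSmoothForm (∑ i ∈ s, f i) :=
  Finset.sum_induction _ IsSmoothForm (fun _ _ => IsSmoothForm.add) isSmoothForm_zero hf

/-- The change of coordinates from the chart around `i` to the chart around `j`. -/
def coordChange (i j : X) : PartialEquiv E3 E3 :=
  (extChartAt (𝓡 3) i).symm.trans (extChartAt (𝓡 3) j)

theorem mem_coordChange_source {i j : X} {y : E3} :
    y ∈ (coordChange i j).source ↔ y ∈ (extChartAt (𝓡 3) i).target ∧
      (extChartAt (𝓡 3) i).symm y ∈ (extChartAt (𝓡 3) j).source :=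
  Iff.rfl

theorem isOpen_coordChange_source (i j : X) : IsOpen (coordChange i j).source :=
  (continuousOn_extChartAt_symm i).isOpen_inter_preimage (isOpen_extChartAt_target i)
    (isOpen_extChartAt_source j)

theorem coordChange_mem_target {i j : X} {y : E3} (hy : y ∈ (coordChange i j).source) :
    coordChange i j y ∈ (extChartAt (𝓡 3) j).target :=
  (extChartAt (𝓡 3) j).map_source hy.2

theorem extChartAt_symm_coordChange {i j : X} {y : E3} (hy : y ∈ (coordChange i j).source) :
    (extChartAt (𝓡 3) j).symm (coordChange i j y) = (extChartAt (𝓡 3) i).symm y :=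
  (extChartAt (𝓡 3) j).left_inv hy.2

theorem mfderivWithin_extChartAt_symm_eq_chartSymmD (i : X) (y : E3) :
    mfderivWithin 𝓘(ℝ, E3) (𝓡 3) (extChartAt (𝓡 3) i).symm (Set.range (𝓡 3)) y =
      chartSymmD i y := by
  rw [ModelWithCorners.range_eq_univ, mfderivWithin_univ]
  rfl

variable [IsManifold (𝓡 3) ∞ X]

theorem contMDiff_iff_contDiffOn_comp_extChartAt_symm {σ : X → ℝ} :
    ContMDiff (𝓡 3) 𝓘(ℝ, ℝ) ∞ σ ↔
      ∀ i, ContDiffOn ℝ ∞ (fun y => σ ((extChartAt (𝓡 3) i).symm y))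
        (extChartAt (𝓡 3) i).target := by
  refine ⟨fun hσ i => ?_, fun hσ x => ?_⟩
  · exact contMDiffOn_iff_contDiffOn.1
      (hσ.comp_contMDiffOn (contMDiffOn_extChartAt_symm (I := 𝓡 3) (n := ∞) i))
  · rw [contMDiffAt_iff_source, ModelWithCorners.range_eq_univ, contMDiffWithinAt_univ]
    exact ((hσ x).contDiffAt (extChartAt_target_mem_nhds x)).contMDiffAt

theorem differentiableAt_comp_extChartAt_symm {σ : X → ℝ} (hσ : ContMDiff (𝓡 3) 𝓘(ℝ, ℝ) ∞ σ)
    (x : X) :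
    DifferentiableAt ℝ (fun y => σ ((extChartAt (𝓡 3) x).symm y)) (extChartAt (𝓡 3) x x) :=
  ((contMDiff_iff_contDiffOn_comp_extChartAt_symm.1 hσ x).contDiffAt
    (extChartAt_target_mem_nhds x)).differentiableAt (by simp)

theorem IsSmoothForm.smulForm {σ : X → ℝ} {η : DiffForm X k} (hη : IsSmoothForm η)
    (hσ : ContMDiff (𝓡 3) 𝓘(ℝ, ℝ) ∞ σ) : IsSmoothForm (smulForm σ η) := fun i => by
  rw [formRep_smulForm]
  exact (contMDiff_iff_contDiffOn_comp_extChartAt_symm.1 hσ i).smul (hη i)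

theorem chartD_self (x : X) : chartD x x = ContinuousLinearMap.id ℝ E3 :=
  haveI : IsManifold (𝓡 3) 1 X := .of_le (n := ∞) (by simp)
  mfderiv_extChartAt_self

theorem chartSymmD_self (x : X) :
    chartSymmD x (extChartAt (𝓡 3) x x) = ContinuousLinearMap.id ℝ E3 := by
  have : IsManifold (𝓡 3) 1 X := .of_le (n := ∞) (by simp)
  rw [← mfderivWithin_extChartAt_symm_eq_chartSymmD]
  exact mfderivWithin_range_extChartAt_symm

theorem chartSymmD_comp_chartD {i : X} {y : E3} (hy : y ∈ (extChartAt (𝓡 3) i).target) :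
    chartSymmD i y ∘L chartD i ((extChartAt (𝓡 3) i).symm y) = ContinuousLinearMap.id ℝ E3 := by
  have : IsManifold (𝓡 3) 1 X := .of_le (n := ∞) (by simp)
  have h := mfderivWithin_extChartAt_symm_comp_mfderiv_extChartAt (I := 𝓡 3) hy
  rw [mfderivWithin_extChartAt_symm_eq_chartSymmD] at h
  exact h

theorem formRep_self (η : DiffForm X k) (x : X) : formRep η x (extChartAt (𝓡 3) x x) = η x := by
  rw [formRep, chartSymmD_self, extChartAt_to_inv]
  rfl

theorem fieldRep_self (w : X → E3) (x : X) : fieldRep w x (extChartAt (𝓡 3) x x) = w x := by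
  rw [fieldRep, extChartAt_to_inv, chartD_self]
  rfl

theorem formRep_compContinuousLinearMap_chartD (η : DiffForm X k) {i : X} {y : E3}
    (hy : y ∈ (extChartAt (𝓡 3) i).target) :
    (formRep η i y).compContinuousLinearMap (chartD i ((extChartAt (𝓡 3) i).symm y)) =
      η ((extChartAt (𝓡 3) i).symm y) := by
  change (η _).compContinuousLinearMap
    (chartSymmD i y ∘L chartD i ((extChartAt (𝓡 3) i).symm y)) = _
  rw [chartSymmD_comp_chartD hy]
  rfl

theorem formRep_apply_fieldRep (α : DiffForm X 1) (w : X → E3) {i : X} {y : E3}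
    (hy : y ∈ (extChartAt (𝓡 3) i).target) :
    formRep α i y ![fieldRep w i y] =
      α ((extChartAt (𝓡 3) i).symm y) ![w ((extChartAt (𝓡 3) i).symm y)] := by
  rw [← formRep_compContinuousLinearMap_chartD α hy, oneForm_compContinuousLinearMap_apply]
  rfl

theorem contDiffAt_coordChange {i j : X} {y : E3} (hy : y ∈ (coordChange i j).source) :
    ContDiffAt ℝ ∞ (coordChange i j) y :=
  (contDiffOn_ext_coord_change (I := 𝓡 3) (n := ∞) j i).contDiffAt
    ((isOpen_coordChange_source i j).mem_nhds hy)

theorem fderiv_coordChange {i j : X} {y : E3} (hy : y ∈ (coordChange i j).source) :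
    fderiv ℝ (coordChange i j) y =
      chartD j ((extChartAt (𝓡 3) i).symm y) ∘L chartSymmD i y := by
  have : IsManifold (𝓡 3) 1 X := .of_le (n := ∞) (by simp)
  rw [mem_coordChange_source, extChartAt_source] at hy
  rw [← mfderiv_eq_fderiv]
  exact mfderiv_comp y (mdifferentiableAt_extChartAt hy.2)
    ((mdifferentiableOn_extChartAt_symm y hy.1).mdifferentiableAt
      ((isOpen_extChartAt_target i).mem_nhds hy.1))

theorem formRep_eq_pullback_coordChange (η : DiffForm X k) {i j : X} {y : E3}
    (hy : y ∈ (coordChange i j).source) :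
    formRep η i y = (formRep η j (coordChange i j y)).compContinuousLinearMap
      (fderiv ℝ (coordChange i j) y) := by
  have h := formRep_compContinuousLinearMap_chartD η (coordChange_mem_target hy)
  rw [extChartAt_symm_coordChange hy] at h
  rw [fderiv_coordChange hy, formRep, ← h]
  rfl

theorem extD_apply (η : DiffForm X k) (x : X) :
    extD η x = extDeriv (formRep η x) (extChartAt (𝓡 3) x x) := by
  rw [extD, chartD_self]
  rfl

theorem formRep_extD {η : DiffForm X k} (hη : IsSmoothForm η) {i : X} {y : E3}
    (hy : y ∈ (extChartAt (𝓡 3) i).target) :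
    formRep (extD η) i y = extDeriv (formRep η i) y := by
  set x := (extChartAt (𝓡 3) i).symm y with hx
  have hys : y ∈ (coordChange i x).source := ⟨hy, mem_extChartAt_source x⟩
  have hev : formRep η i =ᶠ[nhds y] fun z => (formRep η x
      (coordChange i x z)).compContinuousLinearMap (fderiv ℝ (coordChange i x) z) := by
    filter_upwards [(isOpen_coordChange_source i x).mem_nhds hys] with z hz
    exact formRep_eq_pullback_coordChange η hz
  have hr : minSmoothness ℝ 2 ≤ (∞ : ℕ∞ω) := by
    rw [minSmoothness_of_isRCLikeNormedField]
    exact ENat.LEInfty.out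
  rw [hev.extDeriv_eq, extDeriv_pullback (hη.differentiableAt (coordChange_mem_target hys))
    (contDiffAt_coordChange hys) hr, fderiv_coordChange hys, ← hx, chartD_self,
    ContinuousLinearMap.id_comp, formRep, ← hx, extD_apply]
  rfl

theorem IsSmoothForm.extD {η : DiffForm X k} (hη : IsSmoothForm η) :
    IsSmoothForm (extD η) := fun i => by
  refine ContDiffOn.congr ?_ fun y hy => formRep_extD hη hy
  exact (ContinuousAlternatingMap.alternatizeUncurryFinCLM ℝ E3 ℝ).contDiff.comp_contDiffOn
    ((hη i).fderiv_of_isOpen (m := ∞) (isOpen_extChartAt_target i) (by simp))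

end Charts

section Leibniz

variable {X : Type*} [TopologicalSpace X] [ChartedSpace E3 X] [IsManifold (𝓡 3) ∞ X] {k : ℕ}

theorem extD_zero : extD (0 : DiffForm X k) = 0 := by
  funext x
  rw [extD_apply, formRep_zero]
  exact extDeriv_fun_zero _

theorem extD_add {η θ : DiffForm X k} (hη : IsSmoothForm η) (hθ : IsSmoothForm θ) :
    extD (η + θ) = extD η + extD θ := by
  funext x
  rw [Pi.add_apply, extD_apply, extD_apply, extD_apply, formRep_add,
    extDeriv_add (hη.differentiableAt (mem_extChartAt_target x))
      (hθ.differentiableAt (mem_extChartAt_target x))]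

theorem extD_sum {ι : Type*} (s : Finset ι) {f : ι → DiffForm X k}
    (hf : ∀ i ∈ s, IsSmoothForm (f i)) : extD (∑ i ∈ s, f i) = ∑ i ∈ s, extD (f i) := by
  classical
  induction s using Finset.induction_on with
  | empty => simp only [Finset.sum_empty, extD_zero]
  | insert a s ha ih =>
    rw [Finset.forall_mem_insert] at hf
    rw [Finset.sum_insert ha, Finset.sum_insert ha, extD_add hf.1 (.sum hf.2), ih hf.2]

/-- A function regarded as a zero-form, so that `extD (funForm σ)` is its differential `dσ`. -/
def funForm (σ : X → ℝ) : DiffForm X 0 := fun x =>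
  ContinuousAlternatingMap.constOfIsEmpty ℝ E3 (Fin 0) (σ x)

theorem extD_funForm_apply (σ : X → ℝ) (x : X) :
    extD (funForm σ) x = ContinuousAlternatingMap.ofSubsingleton ℝ E3 ℝ (0 : Fin 1)
      (fderiv ℝ (fun y => σ ((extChartAt (𝓡 3) x).symm y)) (extChartAt (𝓡 3) x x)) := by
  rw [extD_apply, ← extDeriv_constOfIsEmpty]
  rfl

theorem extD_smulForm {σ : X → ℝ} (hσ : ContMDiff (𝓡 3) 𝓘(ℝ, ℝ) ∞ σ) {η : DiffForm X k}
    (hη : IsSmoothForm η) :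
    extD (smulForm σ η) = wedge (extD (funForm σ)) η + smulForm σ (extD η) := by
  funext x
  have h := extDeriv_fun_mul (differentiableAt_comp_extChartAt_symm hσ x)
    (hη.differentiableAt (mem_extChartAt_target x))
  rw [← formRep_smulForm, ← extD_apply, ← extD_apply, ← extD_funForm_apply, formRep_self,
    extChartAt_to_inv] at h
  exact h

theorem extD_wedge {α β : DiffForm X 1} (hα : IsSmoothForm α) (hβ : IsSmoothForm β) :
    extD (wedge α β) = wedge β (extD α) - wedge α (extD β) := by
  funext x
  have h := extDeriv_wedgeOne (hα.differentiableAt (mem_extChartAt_target x))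
    (hβ.differentiableAt (mem_extChartAt_target x))
  rw [← formRep_wedge, ← extD_apply, ← extD_apply, ← extD_apply, formRep_self, formRep_self] at h
  exact h

theorem contMDiff_oneForm_apply {w : X → E3} (hw : IsSmoothField w) {α : DiffForm X 1}
    (hα : IsSmoothForm α) : ContMDiff (𝓡 3) 𝓘(ℝ, ℝ) ∞ (fun x => α x ![w x]) :=
  contMDiff_iff_contDiffOn_comp_extChartAt_symm.2 fun i => by
    refine ContDiffOn.congr ?_ fun y hy => (formRep_apply_fieldRep α w hy).symm
    simp only [← ofSubsingleton_symm_apply]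
    exact ((ContinuousAlternatingMap.ofSubsingletonLIE (𝕜 := ℝ) (E := E3) (F := ℝ)
      (0 : Fin 1)).symm.contDiff.comp_contDiffOn (hα i)).clm_apply (hw i)

theorem lieD_eq_interior_extD_add {w : X → E3} (hw : IsSmoothField w) {α : DiffForm X 1}
    (hα : IsSmoothForm α) :
    lieD w α = interior w (extD α) + extD (funForm fun x => α x ![w x]) := by
  refine funext fun x => oneForm_ext fun v => ?_
  have hαd := hα.differentiableAt (mem_extChartAt_target (I := 𝓡 3) x)
  have hwd : DifferentiableAt ℝ (fieldRep w x) (extChartAt (𝓡 3) x x) :=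
    ((hw x).contDiffAt (extChartAt_target_mem_nhds x)).differentiableAt (by simp)
  have hev : (fun y => α ((extChartAt (𝓡 3) x).symm y) ![w ((extChartAt (𝓡 3) x).symm y)])
      =ᶠ[nhds (extChartAt (𝓡 3) x x)] fun y => formRep α x y ![fieldRep w x y] := by
    filter_upwards [extChartAt_target_mem_nhds (I := 𝓡 3) x] with y hy
    exact (formRep_apply_fieldRep α w hy).symm
  have hd : extD (funForm fun x => α x ![w x]) x ![v] =
      fderiv ℝ (formRep α x) (extChartAt (𝓡 3) x x) v ![w x] +
        α x ![fderiv ℝ (fieldRep w x) (extChartAt (𝓡 3) x x) v] := by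
    rw [extD_funForm_apply, hev.fderiv_eq, ← formRep_self α x, ← fieldRep_self w x,
      ← fderiv_oneForm_apply hαd hwd, ← ofSubsingleton_symm_apply, Equiv.symm_apply_apply]
  have hi : interior w (extD α) x ![v] = fderiv ℝ (formRep α x) (extChartAt (𝓡 3) x x) (w x) ![v] -
      fderiv ℝ (formRep α x) (extChartAt (𝓡 3) x x) v ![w x] := by
    rw [← extDeriv_apply_two hαd, ← extD_apply]
    rfl
  have hl : lieD w α x ![v] = fderiv ℝ (formRep α x) (extChartAt (𝓡 3) x x) (w x) ![v] +
      α x ![fderiv ℝ (fieldRep w x) (extChartAt (𝓡 3) x x) v] := by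
    rw [lieD, chartD_self, fieldRep_self, formRep_self, ← oneForm_compContinuousLinearMap_apply]
    rfl
  change _ = interior w (extD α) x ![v] + extD (funForm fun x => α x ![w x]) x ![v]
  rw [hl, hi, hd]
  ring

end Leibniz

/-! ### Volume forms and Stokes' theorem -/

section VolumeForms

/-- The standard frame of the model space as a basis. -/
def stdBasis : Module.Basis (Fin 3) ℝ E3 := (EuclideanSpace.basisFun (Fin 3) ℝ).toBasis

theorem coe_stdBasis : ⇑stdBasis = stdFrame :=
  funext fun i => by simp [stdBasis, stdFrame]

variable {X : Type*} {μ : DiffForm X 3}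

theorem apply_stdFrame_ne_zero {η : E3 [⋀^Fin 3]→L[ℝ] ℝ} (h : η ≠ 0) : η stdFrame ≠ 0 := by
  rw [← coe_stdBasis]
  exact mt (topForm_eq_zero stdBasis) h

theorem eq_smulForm_quot (hμ : ∀ x, μ x ≠ 0) (η : DiffForm X 3) :
    η = smulForm (quot η μ) μ := by
  funext x
  ext v
  change η x v = η x stdFrame / μ x stdFrame * μ x v
  rw [topForm_eq_smul_det stdBasis (η x) v, topForm_eq_smul_det stdBasis (μ x) v, coe_stdBasis,
    ← mul_assoc, div_mul_cancel₀ _ (apply_stdFrame_ne_zero (hμ x))]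

theorem quot_smulForm (hμ : ∀ x, μ x ≠ 0) (σ : X → ℝ) : quot (smulForm σ μ) μ = σ :=
  funext fun x => mul_div_cancel_right₀ (σ x) (apply_stdFrame_ne_zero (hμ x))

variable [TopologicalSpace X] [ChartedSpace E3 X]

/-- A volume form: a smooth, nowhere vanishing three-form. It orients the manifold. -/
structure IsVolumeForm (μ : DiffForm X 3) : Prop where
  smooth : IsSmoothForm μ
  ne_zero : ∀ x, μ x ≠ 0

variable [IsManifold (𝓡 3) ∞ X]

theorem formRep_stdFrame_ne_zero (hμ : ∀ x, μ x ≠ 0) {j : X} {y : E3}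
    (hy : y ∈ (extChartAt (𝓡 3) j).target) : formRep μ j y stdFrame ≠ 0 := by
  refine apply_stdFrame_ne_zero fun h => hμ ((extChartAt (𝓡 3) j).symm y) ?_
  rw [← formRep_compContinuousLinearMap_chartD μ hy, h]
  rfl

theorem quot_extChartAt_symm (hμ : ∀ x, μ x ≠ 0) (η : DiffForm X 3) {i : X} {y : E3}
    (hy : y ∈ (extChartAt (𝓡 3) i).target) :
    quot η μ ((extChartAt (𝓡 3) i).symm y) =
      formRep η i y stdFrame / formRep μ i y stdFrame := by
  conv_rhs => rw [eq_smulForm_quot hμ η, formRep_smulForm]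
  exact (mul_div_cancel_right₀ _ (formRep_stdFrame_ne_zero hμ hy)).symm

theorem IsSmoothForm.contMDiff_quot {η : DiffForm X 3} (hη : IsSmoothForm η)
    (hμ : IsVolumeForm μ) : ContMDiff (𝓡 3) 𝓘(ℝ, ℝ) ∞ (quot η μ) :=
  contMDiff_iff_contDiffOn_comp_extChartAt_symm.2 fun i =>
    have eval {θ : DiffForm X 3} (hθ : IsSmoothForm θ) : ContDiffOn ℝ ∞
        (fun y => formRep θ i y stdFrame) (extChartAt (𝓡 3) i).target :=
      (ContinuousAlternatingMap.apply ℝ E3 ℝ stdFrame).contDiff.comp_contDiffOn (hθ i)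
    ((eval hη).div (eval hμ.smooth) fun _ => formRep_stdFrame_ne_zero hμ.ne_zero).congr
      fun _ => quot_extChartAt_symm hμ.ne_zero η

end VolumeForms

section Stokes

open MeasureTheory Filter

theorem abs_mul_sign_mul (d m z : ℝ) : |d| * (m.sign * z) = (d * m).sign * (d * z) := by
  rcases lt_trichotomy d 0 with hd | rfl | hd <;> rcases lt_trichotomy m 0 with hm | rfl | hm <;>
    simp [*, abs_of_neg, abs_of_pos, Real.sign_of_neg, Real.sign_of_pos, mul_pos_of_neg_of_neg,
      mul_neg_of_neg_of_pos, mul_neg_of_pos_of_neg]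

variable {X : Type*} [TopologicalSpace X] [ChartedSpace E3 X] {k : ℕ} {μ : DiffForm X 3} {j : X}

/-- The coordinate expression of `ζ` in the chart around `j`, with the sign that compares the
orientation of the chart with that given by `μ`, extended by zero off the chart. -/
def orientedRep (μ : DiffForm X 3) (j : X) (ζ : DiffForm X k) : E3 → E3 [⋀^Fin k]→L[ℝ] ℝ :=
  (extChartAt (𝓡 3) j).target.indicator
    fun y => Real.sign (formRep μ j y stdFrame) • formRep ζ j y

/-- The integral of `ζ` over the domain of the chart around `j`, oriented by `μ`. -/
def chartIntegral (μ : DiffForm X 3) (j : X) (ζ : DiffForm X 3) : ℝ :=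
  ∫ y, orientedRep μ j ζ y stdFrame

theorem chartIntegral_eq_setIntegral (μ : DiffForm X 3) (j : X) (ζ : DiffForm X 3) :
    chartIntegral μ j ζ = ∫ y in (extChartAt (𝓡 3) j).target,
      Real.sign (formRep μ j y stdFrame) * formRep ζ j y stdFrame := by
  rw [chartIntegral, ← integral_indicator (isOpen_extChartAt_target j).measurableSet]
  exact integral_congr_ae (.of_forall fun y => congrFun
    (Set.indicator_comp_of_zero (g := fun η : E3 [⋀^Fin 3]→L[ℝ] ℝ => η stdFrame) rfl).symm y)

theorem formRep_eq_zero {ζ : DiffForm X k} {y : E3}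
    (h : ζ ((extChartAt (𝓡 3) j).symm y) = 0) : formRep ζ j y = 0 := by
  rw [formRep, h]
  rfl

theorem support_orientedRep_subset (ζ : DiffForm X k) :
    Function.support (orientedRep μ j ζ) ⊆ extChartAt (𝓡 3) j '' tsupport ζ := by
  intro y hy
  obtain ⟨hyt, hy⟩ := Set.indicator_apply_ne_zero.1 hy
  refine ⟨_, subset_tsupport _ fun h => hy ?_, (extChartAt (𝓡 3) j).right_inv hyt⟩
  change _ • formRep ζ j y = 0
  rw [formRep_eq_zero h, smul_zero]

theorem isCompact_extChartAt_image_tsupport [CompactSpace X] {ζ : DiffForm X k}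
    (hs : tsupport ζ ⊆ (extChartAt (𝓡 3) j).source) :
    IsCompact (extChartAt (𝓡 3) j '' tsupport ζ) :=
  (isClosed_tsupport ζ).isCompact.image_of_continuousOn ((continuousOn_extChartAt j).mono hs)

theorem hasCompactSupport_orientedRep [CompactSpace X] {ζ : DiffForm X k}
    (hs : tsupport ζ ⊆ (extChartAt (𝓡 3) j).source) : HasCompactSupport (orientedRep μ j ζ) :=
  .of_support_subset_isCompact (isCompact_extChartAt_image_tsupport hs)
    (support_orientedRep_subset ζ)

theorem eventually_orientedRep_eq_zero [CompactSpace X] {ζ : DiffForm X k}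
    (hs : tsupport ζ ⊆ (extChartAt (𝓡 3) j).source) {y : E3}
    (hy : y ∉ (extChartAt (𝓡 3) j).target) : orientedRep μ j ζ =ᶠ[nhds y] fun _ => 0 := by
  have hy' : y ∉ extChartAt (𝓡 3) j '' tsupport ζ := fun ⟨x, hx, hxy⟩ =>
    hy (hxy ▸ (extChartAt (𝓡 3) j).map_source (hs hx))
  filter_upwards [(isCompact_extChartAt_image_tsupport hs).isClosed.isOpen_compl.mem_nhds hy']
    with z hz
  exact Function.notMem_support.1 fun h => hz (support_orientedRep_subset ζ h)

theorem chartIntegral_eq_integral_coordChange {i : X} {ζ : DiffForm X 3}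
    (hj : tsupport ζ ⊆ (extChartAt (𝓡 3) j).source) :
    chartIntegral μ i ζ = ∫ y in (coordChange i j).source,
      Real.sign (formRep μ i y stdFrame) * formRep ζ i y stdFrame := by
  rw [chartIntegral_eq_setIntegral]
  refine setIntegral_eq_of_subset_of_forall_sdiff_eq_zero
    (isOpen_extChartAt_target i).measurableSet (fun _ hy => hy.1) fun y hy => ?_
  have h : ζ ((extChartAt (𝓡 3) i).symm y) = 0 :=
    image_eq_zero_of_notMem_tsupport fun h => hy.2 ⟨hy.1, hj h⟩
  rw [formRep_eq_zero h]
  exact mul_zero _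

variable [IsManifold (𝓡 3) ∞ X]

theorem IsVolumeForm.eventually_sign_eq (hμ : IsVolumeForm μ) {y : E3}
    (hy : y ∈ (extChartAt (𝓡 3) j).target) :
    ∀ᶠ z in nhds y, Real.sign (formRep μ j z stdFrame) = Real.sign (formRep μ j y stdFrame) := by
  have hc : ContinuousAt (fun z => formRep μ j z stdFrame) y :=
    (ContinuousAlternatingMap.apply ℝ E3 ℝ stdFrame).continuous.continuousAt.comp
      (hμ.smooth.differentiableAt hy).continuousAt
  rcases lt_or_gt_of_ne (formRep_stdFrame_ne_zero hμ.ne_zero hy) with h | h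
  · filter_upwards [hc.eventually (gt_mem_nhds h)] with z hz
    rw [Real.sign_of_neg hz, Real.sign_of_neg h]
  · filter_upwards [hc.eventually (lt_mem_nhds h)] with z hz
    rw [Real.sign_of_pos hz, Real.sign_of_pos h]

theorem IsVolumeForm.eventually_orientedRep_eq (hμ : IsVolumeForm μ) (ζ : DiffForm X k) {y : E3}
    (hy : y ∈ (extChartAt (𝓡 3) j).target) :
    orientedRep μ j ζ =ᶠ[nhds y] Real.sign (formRep μ j y stdFrame) • formRep ζ j := by
  filter_upwards [hμ.eventually_sign_eq hy, (isOpen_extChartAt_target j).mem_nhds hy] with z hz hzt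
  rw [orientedRep, Set.indicator_of_mem hzt, hz]
  rfl

theorem chartIntegral_congr_chart (μ : DiffForm X 3) {i j : X} {ζ : DiffForm X 3}
    (hi : tsupport ζ ⊆ (extChartAt (𝓡 3) i).source)
    (hj : tsupport ζ ⊆ (extChartAt (𝓡 3) j).source) :
    chartIntegral μ i ζ = chartIntegral μ j ζ := by
  have himage : coordChange i j '' (coordChange i j).source = (coordChange j i).source :=
    (coordChange i j).image_source_eq_target
  rw [chartIntegral_eq_integral_coordChange hj, chartIntegral_eq_integral_coordChange hi, ← himage,
    integral_image_eq_integral_abs_det_fderiv_smul volume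
      (isOpen_coordChange_source i j).measurableSet (fun y hy =>
        ((contDiffAt_coordChange hy).differentiableAt (by simp)).hasFDerivAt.hasFDerivWithinAt)
      (coordChange i j).injOn]
  refine setIntegral_congr_fun (isOpen_coordChange_source i j).measurableSet fun y hy => ?_
  simp only [formRep_eq_pullback_coordChange _ hy, ← coe_stdBasis, topForm_comp_apply, smul_eq_mul,
    abs_mul_sign_mul]

theorem tsupport_extD_subset (η : DiffForm X k) : tsupport (extD η) ⊆ tsupport η := by
  refine closure_minimal (fun x hx => ?_) (isClosed_tsupport η)
  by_contra h
  have hev : formRep η x =ᶠ[nhds (extChartAt (𝓡 3) x x)] fun _ => 0 := by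
    have hx' := continuousAt_extChartAt_symm (I := 𝓡 3) x
    rw [ContinuousAt, extChartAt_to_inv] at hx'
    filter_upwards [hx' ((isClosed_tsupport η).isOpen_compl.mem_nhds h)] with z hz
    exact formRep_eq_zero (image_eq_zero_of_notMem_tsupport hz)
  exact hx ((extD_apply η x).trans (hev.extDeriv_eq.trans (extDeriv_fun_zero _)))

variable [CompactSpace X]

theorem IsVolumeForm.contDiff_orientedRep (hμ : IsVolumeForm μ) {ζ : DiffForm X k}
    (hζ : IsSmoothForm ζ) (hs : tsupport ζ ⊆ (extChartAt (𝓡 3) j).source) :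
    ContDiff ℝ ∞ (orientedRep μ j ζ) := by
  refine contDiff_iff_contDiffAt.2 fun y => ?_
  by_cases hy : y ∈ (extChartAt (𝓡 3) j).target
  · exact (((hζ j).contDiffAt ((isOpen_extChartAt_target j).mem_nhds hy)).const_smul
      (Real.sign (formRep μ j y stdFrame))).congr_of_eventuallyEq
      (hμ.eventually_orientedRep_eq ζ hy)
  · exact contDiffAt_const.congr_of_eventuallyEq (eventually_orientedRep_eq_zero hs hy)

theorem IsVolumeForm.extDeriv_orientedRep (hμ : IsVolumeForm μ) {ζ : DiffForm X k}
    (hζ : IsSmoothForm ζ) (hs : tsupport ζ ⊆ (extChartAt (𝓡 3) j).source) (y : E3) :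
    extDeriv (orientedRep μ j ζ) y = orientedRep μ j (extD ζ) y := by
  by_cases hy : y ∈ (extChartAt (𝓡 3) j).target
  · rw [(hμ.eventually_orientedRep_eq ζ hy).extDeriv_eq, extDeriv_smul,
      (hμ.eventually_orientedRep_eq (extD ζ) hy).eq_of_nhds, Pi.smul_apply, formRep_extD hζ hy]
  · rw [(eventually_orientedRep_eq_zero hs hy).extDeriv_eq, extDeriv_fun_zero, orientedRep,
      Set.indicator_of_notMem hy]

theorem IsVolumeForm.chartIntegral_extD (hμ : IsVolumeForm μ) {ζ : DiffForm X 2}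
    (hζ : IsSmoothForm ζ) (hs : tsupport ζ ⊆ (extChartAt (𝓡 3) j).source) :
    chartIntegral μ j (extD ζ) = 0 := by
  simp only [chartIntegral, ← hμ.extDeriv_orientedRep hζ hs]
  exact integral_extDeriv_apply_eq_zero volume ((hμ.contDiff_orientedRep hζ hs).of_le (by simp))
    (hasCompactSupport_orientedRep hs) stdFrame

theorem IsVolumeForm.integrable_orientedRep (hμ : IsVolumeForm μ) {ζ : DiffForm X k}
    (hζ : IsSmoothForm ζ) (hs : tsupport ζ ⊆ (extChartAt (𝓡 3) j).source) (v : Fin k → E3) :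
    Integrable fun y => orientedRep μ j ζ y v :=
  ((ContinuousAlternatingMap.apply ℝ E3 ℝ v).continuous.comp
    (hμ.contDiff_orientedRep hζ hs).continuous).integrable_of_hasCompactSupport
    ((hasCompactSupport_orientedRep hs).comp_left
      (g := fun η : E3 [⋀^Fin k]→L[ℝ] ℝ => η v) rfl)

theorem IsVolumeForm.chartIntegral_sum (hμ : IsVolumeForm μ) {ι : Type*} (s : Finset ι)
    {f : ι → DiffForm X 3} (hf : ∀ i ∈ s, IsSmoothForm (f i))
    (hs : ∀ i ∈ s, tsupport (f i) ⊆ (extChartAt (𝓡 3) j).source) :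
    chartIntegral μ j (∑ i ∈ s, f i) = ∑ i ∈ s, chartIntegral μ j (f i) := by
  simp only [chartIntegral]
  rw [← integral_finsetSum s fun i hi => hμ.integrable_orientedRep (hf i hi) (hs i hi) _]
  refine integral_congr_ae (.of_forall fun y => ?_)
  by_cases hy : y ∈ (extChartAt (𝓡 3) j).target
  · simp only [orientedRep, Set.indicator_of_mem hy]
    simp [formRep, Finset.mul_sum]
  · simp only [orientedRep, Set.indicator_of_notMem hy]
    simp

variable [T2Space X]

theorem tsupport_smulForm_partUnity_subset (η : DiffForm X k) (i : X) :
    tsupport (smulForm (partUnity X i) η) ⊆ (extChartAt (𝓡 3) i).source := by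
  rw [extChartAt_source]
  exact (tsupport_smul_subset_left (partUnity X i) η).trans (partUnity_isSubordinate X i)

variable (X) in
/-- The finitely many indices at which the partition of unity does not vanish identically. -/
def partIndex : Finset X := (partUnity X).locallyFinite.finite_nonempty_of_compact.toFinset

theorem partUnity_eq_zero {i : X} (hi : i ∉ partIndex X) (x : X) : partUnity X i x = 0 := by
  by_contra h
  rw [partIndex, Set.Finite.mem_toFinset] at hi
  exact hi ⟨x, h⟩

theorem sum_smulForm_partUnity (η : DiffForm X k) :
    ∑ i ∈ partIndex X, smulForm (partUnity X i) η = η := by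
  funext x
  have h : ∑ i ∈ partIndex X, partUnity X i x = 1 := by
    rw [← (partUnity X).sum_eq_one (Set.mem_univ x)]
    exact (finsum_eq_sum_of_support_subset _ fun i hi =>
      not_imp_comm.1 (fun h => partUnity_eq_zero h x) hi).symm
  simp only [Finset.sum_apply, smulForm, ← Finset.sum_smul, h, one_smul]

theorem integral_eq_sum (μ η : DiffForm X 3) :
    integral μ η = ∑ i ∈ partIndex X, chartIntegral μ i (smulForm (partUnity X i) η) := by
  have h (i : X) : (∫ y in (extChartAt (𝓡 3) i).target, Real.sign (formRep μ i y stdFrame) *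
      (partUnity X i ((extChartAt (𝓡 3) i).symm y) * formRep η i y stdFrame)) =
      chartIntegral μ i (smulForm (partUnity X i) η) := by
    rw [chartIntegral_eq_setIntegral]
    rfl
  rw [integral, finsum_congr h]
  refine finsum_eq_sum_of_support_subset _ fun i hi => not_imp_comm.1 (fun h' => ?_) hi
  change chartIntegral μ i _ = 0
  rw [← h i]
  simp [partUnity_eq_zero h']

theorem IsVolumeForm.integral_sum (hμ : IsVolumeForm μ) {ι : Type*} (s : Finset ι)
    {f : ι → DiffForm X 3} (hf : ∀ i ∈ s, IsSmoothForm (f i)) :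
    integral μ (∑ i ∈ s, f i) = ∑ i ∈ s, integral μ (f i) := by
  simp only [integral_eq_sum]
  rw [Finset.sum_comm]
  refine Finset.sum_congr rfl fun i _ => ?_
  rw [← hμ.chartIntegral_sum s (fun j hj => (hf j hj).smulForm (partUnity X i).contMDiff)
    fun j _ => tsupport_smulForm_partUnity_subset (f j) i]
  exact congrArg _ (Finset.smul_sum (r := ⇑(partUnity X i)))

theorem IsVolumeForm.integral_add (hμ : IsVolumeForm μ) {η θ : DiffForm X 3} (hη : IsSmoothForm η)
    (hθ : IsSmoothForm θ) : integral μ (η + θ) = integral μ η + integral μ θ := by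
  simpa using hμ.integral_sum (f := ![η, θ]) Finset.univ (by simp [Fin.forall_fin_two, hη, hθ])

theorem integral_neg (μ η : DiffForm X 3) : integral μ (-η) = -integral μ η := by
  have h (i : X) (y : E3) : formRep (-η) i y stdFrame = -formRep η i y stdFrame := rfl
  simp only [integral, h, mul_neg, MeasureTheory.integral_neg, finsum_neg_distrib]

theorem IsVolumeForm.integral_extD_eq_zero_of_tsupport_subset (hμ : IsVolumeForm μ)
    {θ : DiffForm X 2} (hθ : IsSmoothForm θ) (hs : tsupport θ ⊆ (extChartAt (𝓡 3) j).source) :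
    integral μ (extD θ) = 0 := by
  have hs' (i : X) : tsupport (smulForm (partUnity X i) (extD θ)) ⊆ (extChartAt (𝓡 3) j).source :=
    (tsupport_smul_subset_right _ _).trans ((tsupport_extD_subset θ).trans hs)
  rw [integral_eq_sum, Finset.sum_congr rfl fun i _ => chartIntegral_congr_chart μ
      (tsupport_smulForm_partUnity_subset (extD θ) i) (hs' i),
    ← hμ.chartIntegral_sum _ (fun i _ => hθ.extD.smulForm (partUnity X i).contMDiff)
      fun i _ => hs' i,
    sum_smulForm_partUnity, hμ.chartIntegral_extD hθ hs]

theorem IsVolumeForm.integral_extD (hμ : IsVolumeForm μ) {θ : DiffForm X 2}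
    (hθ : IsSmoothForm θ) : integral μ (extD θ) = 0 := by
  have hs (i : X) : IsSmoothForm (smulForm (partUnity X i) θ) :=
    hθ.smulForm (partUnity X i).contMDiff
  rw [← sum_smulForm_partUnity θ, extD_sum _ fun i _ => hs i,
    hμ.integral_sum _ fun i _ => (hs i).extD]
  exact Finset.sum_eq_zero fun i _ => hμ.integral_extD_eq_zero_of_tsupport_subset (hs i)
    (tsupport_smulForm_partUnity_subset θ i)

end Stokes

/-! ### Hodge stars of a contact metric structure -/

section Pairings

variable {V : Type*} [NormedAddCommGroup V] [NormedSpace ℝ V]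

/-- The bilinear form `(u, v) ↦ β (u, v)` of a two-form `β`, from which bilinearity is inherited. -/
def twoFormBilin (β : V [⋀^Fin 2]→L[ℝ] ℝ) : V →L[ℝ] V →L[ℝ] ℝ :=
  ((ContinuousAlternatingMap.ofSubsingletonLIE (𝕜 := ℝ) (E := V) (F := ℝ)
    (0 : Fin 1)).symm : (V [⋀^Fin 1]→L[ℝ] ℝ) →L[ℝ] (V →L[ℝ] ℝ)) ∘L β.curryLeft

theorem twoFormBilin_apply (β : V [⋀^Fin 2]→L[ℝ] ℝ) (u v : V) : twoFormBilin β u v = β ![u, v] :=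
  ofSubsingleton_symm_apply (β.curryLeft u) v

theorem twoFormBilin_swap (β : V [⋀^Fin 2]→L[ℝ] ℝ) (u v : V) :
    twoFormBilin β u v = -twoFormBilin β v u := by
  simp only [twoFormBilin_apply]
  exact congrArg (fun η => η ![]) (curryLeft_curryLeft_comm β u v)

end Pairings

section OrthonormalFrames

variable {V : Type*} [NormedAddCommGroup V] [NormedSpace ℝ V] {B : LinearMap.BilinForm ℝ V}
  {e : Module.Basis (Fin 3) ℝ V}

theorem exists_isOrthonormalFrame [FiniteDimensional ℝ V] (hV : Module.finrank ℝ V = 3)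
    (hs : LinearMap.IsSymm B) (hp : ∀ v, v ≠ 0 → 0 < B v v) :
    ∃ e : Module.Basis (Fin 3) ℝ V, IsOrthonormalFrame (fun u v => B u v) e := by
  obtain ⟨b, hb⟩ := LinearMap.BilinForm.exists_orthogonal_basis hs
  let c := b.reindex (finCongr hV)
  have hpos (i) : 0 < B (c i) (c i) := hp _ (c.ne_zero i)
  have horth (i j) (hij : i ≠ j) : B (c i) (c j) = 0 := by
    simpa [c] using! hb ((finCongr hV).symm.injective.ne hij)
  refine ⟨c.isUnitSMul (w := fun i => (√(B (c i) (c i)))⁻¹) fun i =>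
    (inv_ne_zero (Real.sqrt_pos.2 (hpos i)).ne').isUnit, fun i j => ?_⟩
  simp only [Module.Basis.isUnitSMul_apply, map_smul, LinearMap.smul_apply, smul_eq_mul]
  split_ifs with hij
  · subst hij
    rw [← mul_assoc, ← mul_inv, Real.mul_self_sqrt (hpos i).le, inv_mul_cancel₀ (hpos i).ne']
  · rw [horth i j hij, mul_zero, mul_zero]

theorem IsOrthonormalFrame.apply_left (he : IsOrthonormalFrame (fun u v => B u v) e) (i : Fin 3)
    (v : V) : B (e i) v = e.repr v i := by
  have h : B (e i) = e.coord i := e.ext fun j => by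
    refine (he i j).trans ?_
    rw [e.coord_apply, e.repr_self, Finsupp.single_apply]
    exact if_congr eq_comm rfl rfl
  exact LinearMap.congr_fun h v

theorem IsOrthonormalFrame.sum_apply_smul (he : IsOrthonormalFrame (fun u v => B u v) e) (v : V) :
    ∑ i, B (e i) v • e i = v := by
  simpa only [he.apply_left] using e.sum_repr v

theorem IsOrthonormalFrame.sum_apply_mul_apply (he : IsOrthonormalFrame (fun u v => B u v) e)
    (u v : V) : ∑ i, B (e i) u * B (e i) v = B u v := by
  conv_rhs => rw [← he.sum_apply_smul u]
  simp only [map_sum, map_smul, LinearMap.sum_apply, LinearMap.smul_apply, smul_eq_mul]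

theorem IsOrthonormalFrame.sum_mul_contract (he : IsOrthonormalFrame (fun u v => B u v) e)
    (vol : V [⋀^Fin 3]→L[ℝ] ℝ) (u v : V) :
    ∑ i, ∑ j, vol ![u, e i, e j] * vol ![e i, e j, v] = 2 * vol e ^ 2 * B u v := by
  rw [← he.sum_apply_mul_apply]
  simp only [he.apply_left, topForm_eq_smul_det e vol ![_, _, _], e.det_apply,
    Matrix.det_fin_three, e.toMatrix_apply]
  simp only [Fin.isValue, Matrix.cons_val_zero, Matrix.cons_val_one, Matrix.cons_val,
    Module.Basis.repr_self, Finsupp.single_apply, Fin.sum_univ_three, Fin.reduceEq, ↓reduceIte,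
    zero_ne_one, one_ne_zero, ite_self, mul_ite, ite_mul, mul_one, one_mul, mul_zero, zero_mul,
    sub_self, add_zero, zero_add, zero_sub, sub_zero, neg_zero, mul_neg, neg_mul, neg_neg]
  ring

theorem IsOrthonormalFrame.oneForm_apply (he : IsOrthonormalFrame (fun u v => B u v) e)
    (β : V [⋀^Fin 1]→L[ℝ] ℝ) (v : V) : β ![v] = B (∑ i, β ![e i] • e i) v := by
  simp only [map_sum, LinearMap.sum_apply, map_smul, LinearMap.smul_apply, he.apply_left]
  conv_lhs => rw [← ofSubsingleton_symm_apply, ← e.sum_repr v, map_sum]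
  simp only [map_smul, ofSubsingleton_symm_apply, smul_eq_mul, mul_comm]

theorem hodgeStar_one {g : V → V → ℝ} (h : ∃ e : Module.Basis (Fin 3) ℝ V, IsOrthonormalFrame g e)
    {m : ℕ} (vol : V [⋀^Fin (m + 1)]→L[ℝ] ℝ) (β : V [⋀^Fin 1]→L[ℝ] ℝ) :
    ∃ e : Module.Basis (Fin 3) ℝ V, IsOrthonormalFrame g e ∧
      hodgeStar g vol β = ∑ i, β ![e i] • vol.curryLeft (e i) := by
  refine ⟨h.choose, h.choose_spec, ?_⟩
  rw [hodgeStar, dif_pos h, ← (Equiv.funUnique (Fin 1) (Fin 3)).symm.sum_comp]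
  simp only [Nat.factorial_one, Nat.cast_one, inv_one, one_smul]
  refine Finset.sum_congr rfl fun i _ => ?_
  congr 2
  exact List.ofFn_inj.1 rfl

theorem hodgeStar_two {g : V → V → ℝ} (h : ∃ e : Module.Basis (Fin 3) ℝ V, IsOrthonormalFrame g e)
    {m : ℕ} (vol : V [⋀^Fin (m + 2)]→L[ℝ] ℝ) (β : V [⋀^Fin 2]→L[ℝ] ℝ) :
    ∃ e : Module.Basis (Fin 3) ℝ V, IsOrthonormalFrame g e ∧
      hodgeStar g vol β =
        (2 : ℝ)⁻¹ • ∑ i, ∑ j, β ![e i, e j] • (vol.curryLeft (e i)).curryLeft (e j) := by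
  refine ⟨h.choose, h.choose_spec, ?_⟩
  rw [hodgeStar, dif_pos h, ← (finTwoArrowEquiv (Fin 3)).symm.sum_comp, Fintype.sum_prod_type]
  simp only [Nat.factorial_two, Nat.cast_ofNat]
  congr 1
  refine Finset.sum_congr rfl fun i _ => Finset.sum_congr rfl fun j _ => ?_
  have hij : (fun a => h.choose ((finTwoArrowEquiv (Fin 3)).symm (i, j) a)) =
      ![h.choose i, h.choose j] := List.ofFn_inj.1 rfl
  rw [hij]
  rfl

theorem hodgeStar_one_eq_curryLeft
    (h : ∃ e : Module.Basis (Fin 3) ℝ V, IsOrthonormalFrame (fun u v => B u v) e) {m : ℕ}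
    (vol : V [⋀^Fin (m + 1)]→L[ℝ] ℝ) {β : V [⋀^Fin 1]→L[ℝ] ℝ} {w : V}
    (hw : ∀ v, β ![v] = B v w) : hodgeStar (fun u v => B u v) vol β = vol.curryLeft w := by
  obtain ⟨e, he, hβ⟩ := hodgeStar_one h vol β
  rw [hβ]
  conv_rhs => rw [← he.sum_apply_smul w]
  simp [hw]

theorem hodgeStar_curryLeft_apply
    (h : ∃ e : Module.Basis (Fin 3) ℝ V, IsOrthonormalFrame (fun u v => B u v) e)
    {vol : V [⋀^Fin 3]→L[ℝ] ℝ}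
    (hvol : ∀ e : Module.Basis (Fin 3) ℝ V, IsOrthonormalFrame (fun u v => B u v) e →
      vol e ^ 2 = 1) (u v : V) :
    hodgeStar (fun u v => B u v) (m := 1) vol (vol.curryLeft u) ![v] = B u v := by
  obtain ⟨e, he, hβ⟩ := hodgeStar_two (m := 1) h vol (vol.curryLeft u)
  rw [hβ, ContinuousAlternatingMap.smul_apply, smul_eq_mul]
  have hs : (∑ i, ∑ j, vol.curryLeft u ![e i, e j] • (vol.curryLeft (e i)).curryLeft (e j)) ![v] =
      ∑ i, ∑ j, vol ![u, e i, e j] * vol ![e i, e j, v] := by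
    simp [ContinuousAlternatingMap.sum_apply]
  rw [hs, he.sum_mul_contract, hvol e he]
  ring

end OrthonormalFrames

namespace ContactMetricStructure

variable {X : Type*} [TopologicalSpace X] [ChartedSpace E3 X] (M : ContactMetricStructure X)
  (x : X)

/-- The contact form at `x` as a linear functional. -/
def κFun : E3 →L[ℝ] ℝ := (ContinuousAlternatingMap.ofSubsingleton ℝ E3 ℝ (0 : Fin 1)).symm (M.κ x)

/-- The two-form `dκ` at `x` as a bilinear form. -/
def dκBilin : E3 →L[ℝ] E3 →L[ℝ] ℝ := twoFormBilin (extD M.κ x)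

/-- The metric at `x` as a bilinear form. -/
def gBilin : LinearMap.BilinForm ℝ E3 :=
  LinearMap.mk₂ ℝ (fun u v => M.κFun x u * M.κFun x v + M.dκBilin x u (M.φ x v))
    (fun u v w => by simp only [map_add, add_apply]; ring)
    (fun c u w => by simp only [map_smul, smul_apply, smul_eq_mul]; ring)
    (fun u v w => by simp only [map_add]; ring)
    (fun c u w => by simp only [map_smul, smul_eq_mul]; ring)

variable {x}

theorem κ_apply (v : E3) : M.κ x ![v] = M.κFun x v := (ofSubsingleton_symm_apply _ v).symm

theorem dκ_apply (u v : E3) : extD M.κ x ![u, v] = M.dκBilin x u v :=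
  (twoFormBilin_apply _ u v).symm

theorem gBilin_apply (u v : E3) :
    M.gBilin x u v = M.κFun x u * M.κFun x v + M.dκBilin x u (M.φ x v) := rfl

theorem g_eq_gBilin : M.g x = fun u v => M.gBilin x u v := by
  funext u v
  rw [g, gBilin_apply, κ_apply, κ_apply, dκ_apply]

theorem gBilin_comm (u v : E3) : M.gBilin x u v = M.gBilin x v u := by
  have h : M.g x u v = M.g x v u := M.metric_symm x u v
  rwa [g_eq_gBilin] at h

theorem exists_isOrthonormalFrame_gBilin :
    ∃ e : Module.Basis (Fin 3) ℝ E3, IsOrthonormalFrame (fun u v => M.gBilin x u v) e := by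
  refine exists_isOrthonormalFrame (by simp) ⟨M.gBilin_comm⟩ fun v hv => ?_
  have h : 0 < M.g x v v := M.metric_pos x v hv
  rwa [g_eq_gBilin] at h

theorem κFun_ξ : M.κFun x (M.ξ x) = 1 := by rw [← κ_apply, M.κ_ξ]

theorem dκBilin_ξ_left (v : E3) : M.dκBilin x (M.ξ x) v = 0 := by rw [← dκ_apply, M.dκ_ξ]

theorem dκBilin_ξ_right (v : E3) : M.dκBilin x v (M.ξ x) = 0 := by
  rw [dκBilin, twoFormBilin_swap, ← dκBilin, dκBilin_ξ_left, neg_zero]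

theorem gBilin_ξ_right (v : E3) : M.gBilin x v (M.ξ x) = M.κFun x v := by
  rw [gBilin_apply, κFun_ξ, M.φ_ξ, map_zero, mul_one, add_zero]

theorem projH_apply (v : E3) : M.projH x v = v - M.κFun x v • M.ξ x := by
  rw [← κ_apply]
  exact kernelProj_apply (M.κ x) (M.ξ x) v

theorem κ_projH (v : E3) : M.κ x ![M.projH x v] = 0 := by
  rw [κ_apply, projH_apply, map_sub, map_smul, κFun_ξ, smul_eq_mul, mul_one, sub_self]

theorem φ_projH (v : E3) : M.φ x (M.projH x v) = M.φ x v := by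
  rw [projH_apply, map_sub, map_smul, M.φ_ξ, smul_zero, sub_zero]

theorem κFun_φ (v : E3) : M.κFun x (M.φ x v) = 0 := by
  rw [← φ_projH, ← κ_apply, M.φ_horizontal x _ (M.κ_projH v)]

theorem φ_φ (v : E3) : M.φ x (M.φ x v) = -M.projH x v := by
  rw [← M.φ_projH v, M.φ_sq x _ (M.κ_projH v)]

theorem gBilin_φ_right (u v : E3) : M.gBilin x u (M.φ x v) = -M.dκBilin x u v := by
  rw [gBilin_apply, κFun_φ, φ_φ, projH_apply, map_neg, map_sub, map_smul, dκBilin_ξ_right]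
  simp

theorem gBilin_φ_φ (v : E3) :
    M.gBilin x (M.φ x v) (M.φ x v) = M.gBilin x v v - M.κFun x v * M.κFun x v := by
  rw [gBilin_φ_right, dκBilin, twoFormBilin_swap, neg_neg, ← dκBilin, gBilin_apply,
    add_sub_cancel_left]

theorem curryLeft_ξ_dκ : (extD M.κ x).curryLeft (M.ξ x) = 0 :=
  oneForm_ext (M.dκ_ξ x)

theorem curryLeft_ξ_vol : (M.vol x).curryLeft (M.ξ x) = extD M.κ x := by
  rw [vol, wedge, curryLeft_wedgeOne, M.κ_ξ, curryLeft_ξ_dκ, one_smul, wedgeOne_zero_right,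
    sub_zero]

theorem vol_apply_ξ_right (u v : E3) : M.vol x ![u, v, M.ξ x] = M.dκBilin x u v := by
  rw [← dκ_apply, ← curryLeft_ξ_vol]
  have h (i j k : E3) : M.vol x ![i, j, k] = -M.vol x ![i, k, j] :=
    congrArg (fun η => η ![]) (curryLeft_curryLeft_comm ((M.vol x).curryLeft i) j k)
  have h' : M.vol x ![u, M.ξ x, v] = -M.vol x ![M.ξ x, u, v] :=
    congrArg (fun η => η ![v]) (curryLeft_curryLeft_comm (M.vol x) u (M.ξ x))
  rw [h, h', neg_neg]
  rfl

theorem vol_orthonormalFrame_sq {e : Module.Basis (Fin 3) ℝ E3}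
    (he : IsOrthonormalFrame (fun u v => M.gBilin x u v) e) : M.vol x e ^ 2 = 1 := by
  have hξ : ∑ i, M.κFun x (e i) * M.κFun x (e i) = 1 := by
    simpa only [gBilin_ξ_right, κFun_ξ] using he.sum_apply_mul_apply (M.ξ x) (M.ξ x)
  have hφ (i : Fin 3) : ∑ j, M.dκBilin x (e i) (e j) * M.dκBilin x (e i) (e j) =
      1 - M.κFun x (e i) * M.κFun x (e i) := by
    have h := he.sum_apply_mul_apply (M.φ x (e i)) (M.φ x (e i))
    have hi : M.gBilin x (e i) (e i) = 1 := (he i i).trans (if_pos rfl)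
    rw [gBilin_φ_φ, hi] at h
    rw [← h]
    refine Finset.sum_congr rfl fun j _ => ?_
    rw [gBilin_φ_right, dκBilin, twoFormBilin_swap, neg_mul_neg]
  have h := he.sum_mul_contract (M.vol x) (M.ξ x) (M.ξ x)
  have hl (u v : E3) : M.vol x ![M.ξ x, u, v] = M.dκBilin x u v := by
    rw [← dκ_apply, ← curryLeft_ξ_vol]
    rfl
  simp only [hl, vol_apply_ξ_right, hφ, Finset.sum_sub_distrib, hξ, gBilin_ξ_right, κFun_ξ,
    Finset.sum_const, Finset.card_univ, Fintype.card_fin, nsmul_eq_mul, Nat.cast_ofNat] at h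
  linarith

variable (x) in
theorem exists_oneForm_eq_gBilin (β : E3 [⋀^Fin 1]→L[ℝ] ℝ) :
    ∃ w, ∀ v, β ![v] = M.gBilin x v w := by
  obtain ⟨e, he⟩ := M.exists_isOrthonormalFrame_gBilin (x := x)
  exact ⟨_, fun v => (he.oneForm_apply β v).trans (M.gBilin_comm _ _)⟩

theorem star₁_apply {β : DiffForm X 1} {w : E3} (hw : ∀ v, β x ![v] = M.gBilin x v w) :
    M.star₁ β x = (M.vol x).curryLeft w := by
  rw [star₁, g_eq_gBilin]
  exact hodgeStar_one_eq_curryLeft M.exists_isOrthonormalFrame_gBilin (M.vol x) hw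

theorem star₂_apply {β : DiffForm X 2} {w : E3} (hw : β x = (M.vol x).curryLeft w) (v : E3) :
    M.star₂ β x ![v] = M.gBilin x v w := by
  rw [star₂, g_eq_gBilin, hw, gBilin_comm]
  exact hodgeStar_curryLeft_apply M.exists_isOrthonormalFrame_gBilin
    (fun e he => M.vol_orthonormalFrame_sq he) w v

theorem starH₁_apply (β : DiffForm X 1) (v : E3) : M.starH₁ β x ![v] = β x ![M.φ x v] := by
  obtain ⟨w, hw⟩ := M.exists_oneForm_eq_gBilin x (β x)
  rw [starH₁, interior, M.star₁_apply hw, curryLeft_curryLeft_comm, curryLeft_ξ_vol, hw,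
    gBilin_comm, gBilin_φ_right, ← dκ_apply]
  rfl

theorem starH₁_neg_starH₁ {B : DiffForm X 1} (hB : M.IsHorizontal B) :
    M.starH₁ (-M.starH₁ B) = B := by
  refine funext fun x => oneForm_ext fun v => ?_
  have h : M.starH₁ (-M.starH₁ B) x ![v] = -B x ![M.φ x (M.φ x v)] := by
    rw [← starH₁_apply, starH₁_apply]
    rfl
  have hξ : (ContinuousAlternatingMap.ofSubsingleton ℝ E3 ℝ (0 : Fin 1)).symm (B x) (M.ξ x) = 0 :=
    (ofSubsingleton_symm_apply _ _).trans (hB x)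
  rw [h, φ_φ, projH_apply, ← ofSubsingleton_symm_apply, ← ofSubsingleton_symm_apply, map_neg,
    map_sub, map_smul, hξ, smul_zero, sub_zero, neg_neg]

theorem wedgeOne_κ_eq_curryLeft_vol {β : E3 [⋀^Fin 1]→L[ℝ] ℝ} {w : E3}
    (hw : ∀ v, β ![v] = M.gBilin x v w) :
    wedgeOne (M.κ x) β = (M.vol x).curryLeft (M.φ x w) := by
  have h : (extD M.κ x).curryLeft (M.φ x w) = M.κFun x w • M.κ x - β := oneForm_ext fun v => by
    change extD M.κ x ![M.φ x w, v] = M.κFun x w * M.κ x ![v] - β ![v]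
    rw [dκ_apply, dκBilin, twoFormBilin_swap, ← dκBilin, hw, gBilin_apply, κ_apply]
    ring
  rw [vol, wedge, curryLeft_wedgeOne, h, κ_apply, κFun_φ, zero_smul, wedgeOne_sub_right,
    wedgeOne_smul_right, wedgeOne_self, smul_zero, zero_sub, zero_sub, neg_neg]

theorem star₁_star₂_wedge_κ (B : DiffForm X 1) :
    M.star₁ (M.star₂ (wedge M.κ B)) = wedge M.κ B := by
  funext x
  obtain ⟨w, hw⟩ := M.exists_oneForm_eq_gBilin x (B x)
  have hB : wedge M.κ B x = (M.vol x).curryLeft (M.φ x w) := M.wedgeOne_κ_eq_curryLeft_vol hw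
  rw [hB, M.star₁_apply fun v => M.star₂_apply hB v]

theorem curryLeft_ξ_wedgeOne_κ {k : ℕ} (η : E3 [⋀^Fin (k + 1)]→L[ℝ] ℝ) :
    (wedgeOne (M.κ x) η).curryLeft (M.ξ x) = η.compContinuousLinearMap (M.projH x) := by
  rw [curryLeft_wedgeOne, M.κ_ξ, one_smul]
  exact (compContinuousLinearMap_kernelProj (M.κ_ξ x) η).symm

/-- The function `f` with `κ ∧ dA = f κ ∧ dκ`. -/
def verticalCurvature (A : DiffForm X 1) : X → ℝ := quot (wedge M.κ (extD A)) M.vol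

theorem wedge_κ_extD (A : DiffForm X 1) :
    wedge M.κ (extD A) = smulForm (M.verticalCurvature A) M.vol :=
  eq_smulForm_quot M.contact _

theorem dH_eq_smulForm_dκ (A : DiffForm X 1) :
    M.dH A = smulForm (M.verticalCurvature A) (extD M.κ) := by
  funext x
  rw [dH, ← curryLeft_ξ_wedgeOne_κ, smulForm, ← curryLeft_ξ_vol]
  exact congrArg (fun η => (η x).curryLeft (M.ξ x)) (M.wedge_κ_extD A)

theorem wedge_κ_dH {k : ℕ} (η : DiffForm X k) : wedge M.κ (M.dH η) = wedge M.κ (extD η) :=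
  funext fun x => wedgeOne_compContinuousLinearMap_kernelProj (M.κ_ξ x) _

theorem wedge_κ_interior_extD (A : DiffForm X 1) :
    wedge M.κ (interior M.ξ (extD A)) = extD A - smulForm (M.verticalCurvature A) (extD M.κ) := by
  rw [← dH_eq_smulForm_dκ, eq_sub_iff_add_eq]
  exact funext fun x => add_eq_of_eq_sub' (compContinuousLinearMap_kernelProj (M.κ_ξ x) _)

theorem starH₂_dH (A : DiffForm X 1) :
    M.starH₂ (M.dH A) = funForm (M.verticalCurvature A) := by
  funext x
  ext v
  have hA : M.dH A x = (M.vol x).curryLeft (M.verticalCurvature A x • M.ξ x) := by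
    rw [map_smul, curryLeft_ξ_vol, dH_eq_smulForm_dκ, smulForm]
  have h : M.starH₂ (M.dH A) x v = M.star₂ (M.dH A) x ![M.ξ x] :=
    congrArg (M.star₂ (M.dH A) x) (List.ofFn_inj.1 rfl)
  rw [h, M.star₂_apply hA, map_smul, gBilin_ξ_right, κFun_ξ, smul_eq_mul, mul_one]
  rfl

end ContactMetricStructure

/-! ### The contact operator and the action -/

theorem neg_smulForm {X : Type*} {k : ℕ} (σ : X → ℝ) (η : DiffForm X k) :
    smulForm (-σ) η = -smulForm σ η :=
  funext fun x => neg_smul (σ x) (η x)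

section Contact

variable {X : Type*} [TopologicalSpace X] [ChartedSpace E3 X]

variable [IsManifold (𝓡 3) ∞ X] in
theorem extD_funForm_neg (σ : X → ℝ) : extD (funForm (-σ)) = -extD (funForm σ) := by
  funext x
  rw [Pi.neg_apply, extD_funForm_apply, extD_funForm_apply]
  simp only [Pi.neg_apply]
  rw [fderiv_fun_neg]
  ext v
  simp

namespace ContactMetricStructure

variable (M : ContactMetricStructure X)

/-- The Rumin lift `A - f κ`, with `f` the vertical curvature of `A`. -/
def ruminLift (A : DiffForm X 1) : DiffForm X 1 := A + smulForm (-M.verticalCurvature A) M.κ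

variable {M} in
theorem ruminLift_eq_self {A : DiffForm X 1} (hA : wedge M.κ (extD A) = 0) : M.ruminLift A = A := by
  have hf : M.verticalCurvature A = 0 := by
    rw [verticalCurvature, hA]
    exact funext fun x => zero_div _
  rw [ruminLift, hf, neg_zero]
  exact add_eq_left.2 (funext fun x => zero_smul ℝ _)

variable [IsManifold (𝓡 3) ∞ X]

theorem isVolumeForm_vol : IsVolumeForm M.vol :=
  ⟨M.smooth_κ.wedge M.smooth_κ.extD, M.contact⟩

variable {M} {A : DiffForm X 1} {σ : X → ℝ}

theorem contMDiff_neg_verticalCurvature (hA : IsSmoothForm A) :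
    ContMDiff (𝓡 3) 𝓘(ℝ, ℝ) ∞ (-M.verticalCurvature A) :=
  ((M.smooth_κ.wedge hA.extD).contMDiff_quot M.isVolumeForm_vol).neg

theorem isSmoothForm_ruminLift (hA : IsSmoothForm A) : IsSmoothForm (M.ruminLift A) :=
  hA.add (M.smooth_κ.smulForm (contMDiff_neg_verticalCurvature hA))

theorem extD_add_smulForm_κ (hA : IsSmoothForm A) (hσ : ContMDiff (𝓡 3) 𝓘(ℝ, ℝ) ∞ σ) :
    extD (A + smulForm σ M.κ) =
      extD A + (wedge (extD (funForm σ)) M.κ + smulForm σ (extD M.κ)) := by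
  rw [extD_add hA (M.smooth_κ.smulForm hσ), extD_smulForm hσ M.smooth_κ]

theorem verticalCurvature_add_smulForm_κ (hA : IsSmoothForm A)
    (hσ : ContMDiff (𝓡 3) 𝓘(ℝ, ℝ) ∞ σ) :
    M.verticalCurvature (A + smulForm σ M.κ) = M.verticalCurvature A + σ := by
  have h : wedge M.κ (extD (A + smulForm σ M.κ)) =
      smulForm (M.verticalCurvature A + σ) M.vol := by
    funext x
    have hA' := congrFun (M.wedge_κ_extD A) x
    rw [extD_add_smulForm_κ hA hσ]
    simp only [wedge, smulForm, vol, Pi.add_apply, wedgeOne_add_right, wedgeOne_smul_right,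
      add_smul] at hA' ⊢
    rw [hA', wedgeOne_left_anticomm, wedgeOne_self, wedgeOne_zero_right, neg_zero, zero_add]
  rw [verticalCurvature, h]
  exact quot_smulForm (μ := M.vol) M.contact _

theorem ruminLift_add_smulForm_κ (hA : IsSmoothForm A) (hσ : ContMDiff (𝓡 3) 𝓘(ℝ, ℝ) ∞ σ) :
    M.ruminLift (A + smulForm σ M.κ) = M.ruminLift A := by
  funext x
  simp only [ruminLift, verticalCurvature_add_smulForm_κ hA hσ, smulForm, Pi.add_apply,
    Pi.neg_apply]
  module

theorem wedge_κ_extD_ruminLift (hA : IsSmoothForm A) : wedge M.κ (extD (M.ruminLift A)) = 0 := by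
  rw [wedge_κ_extD, ruminLift,
    verticalCurvature_add_smulForm_κ hA (contMDiff_neg_verticalCurvature hA), add_neg_cancel]
  exact funext fun x => zero_smul ℝ _

variable (M A) in
theorem isRuminLift_ruminLift (hA : IsSmoothForm A) : M.IsRuminLift A (M.ruminLift A) := by
  refine ⟨isSmoothForm_ruminLift hA, fun x v hv => ?_, wedge_κ_extD_ruminLift hA⟩
  change A x ![v] + -M.verticalCurvature A x * M.κ x ![v] = A x ![v]
  rw [hv, mul_zero, add_zero]

theorem exists_eq_add_smulForm_κ (hA : IsSmoothForm A) {l : DiffForm X 1} (hl : IsSmoothForm l)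
    (h : ∀ x (v : E3), M.κ x ![v] = 0 → l x ![v] = A x ![v]) :
    ∃ σ, ContMDiff (𝓡 3) 𝓘(ℝ, ℝ) ∞ σ ∧ l = A + smulForm σ M.κ := by
  refine ⟨fun x => l x ![M.ξ x] - A x ![M.ξ x], (contMDiff_oneForm_apply M.smooth_ξ hl).sub
    (contMDiff_oneForm_apply M.smooth_ξ hA), funext fun x => oneForm_ext fun v => ?_⟩
  have hv := h x _ (M.κ_projH v)
  change l x ![v] = A x ![v] + (l x ![M.ξ x] - A x ![M.ξ x]) * M.κ x ![v]
  rw [κ_apply]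
  simp only [projH_apply, ← ofSubsingleton_symm_apply, map_sub, map_smul, smul_eq_mul] at hv ⊢
  linarith

theorem IsRuminLift.eq_ruminLift {l : DiffForm X 1} (hl : M.IsRuminLift A l)
    (hA : IsSmoothForm A) : l = M.ruminLift A := by
  obtain ⟨hls, hlA, hκl⟩ := hl
  obtain ⟨σ, hσ, rfl⟩ := exists_eq_add_smulForm_κ hA hls hlA
  rw [← ruminLift_add_smulForm_κ hA hσ, ruminLift_eq_self hκl]

theorem lieD_ξ_eq (hA : IsSmoothForm A) (hH : M.IsHorizontal A) :
    lieD M.ξ A = interior M.ξ (extD A) := by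
  have h0 : (funForm fun x => A x ![M.ξ x]) = 0 := by
    funext x
    ext
    exact hH x
  rw [lieD_eq_interior_extD_add M.smooth_ξ hA, h0, extD_zero, add_zero]

theorem D1_eq (hA : IsSmoothForm A) (hH : M.IsHorizontal A) :
    M.D1 A = interior M.ξ (extD A) + M.dH (funForm (M.verticalCurvature A)) := by
  rw [D1, lieD_ξ_eq hA hH, starH₂_dH]

theorem isHorizontal_D1 (hA : IsSmoothForm A) (hH : M.IsHorizontal A) :
    M.IsHorizontal (M.D1 A) := fun x => by
  have hξ : M.projH x (M.ξ x) = 0 := by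
    rw [projH_apply, κFun_ξ, one_smul, sub_self]
  have hi : interior M.ξ (extD A) x ![M.ξ x] = 0 :=
    (extD A x).map_eq_zero_of_eq ![M.ξ x, M.ξ x] (i := 0) (j := 1) rfl (by decide)
  have hd (η : DiffForm X 0) : M.dH η x ![M.ξ x] = 0 := by
    rw [dH, oneForm_compContinuousLinearMap_apply, hξ]
    exact (extD η x).map_coord_zero 0 rfl
  rw [D1_eq hA hH, Pi.add_apply, ContinuousAlternatingMap.add_apply, hi, hd, add_zero]

theorem D_eq_extD_ruminLift (hA : IsSmoothForm A) (hH : M.IsHorizontal A) :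
    M.D A = extD (M.ruminLift A) := by
  have hD : M.D A = wedge M.κ (interior M.ξ (extD A)) +
      wedge M.κ (M.dH (funForm (M.verticalCurvature A))) := by
    rw [D, D1_eq hA hH]
    exact funext fun x => wedgeOne_add_right _ _ _
  rw [hD, wedge_κ_interior_extD, wedge_κ_dH, ruminLift,
    extD_add_smulForm_κ hA (contMDiff_neg_verticalCurvature hA), extD_funForm_neg]
  funext x
  simp only [Pi.add_apply, Pi.sub_apply, Pi.neg_apply, wedge, smulForm]
  rw [wedgeOne_comm (-_) (M.κ x), wedgeOne_neg_right]
  module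

end ContactMetricStructure

end Contact

section Action

variable {X : Type*} [TopologicalSpace X] [ChartedSpace E3 X] [IsManifold (𝓡 3) ∞ X]
  [CompactSpace X] [T2Space X]

theorem IsVolumeForm.integral_wedge_extD_comm {μ : DiffForm X 3} (hμ : IsVolumeForm μ)
    {α β : DiffForm X 1} (hα : IsSmoothForm α) (hβ : IsSmoothForm β) :
    integral μ (wedge α (extD β)) = integral μ (wedge β (extD α)) := by
  have h : wedge β (extD α) = extD (wedge α β) + wedge α (extD β) := by
    rw [extD_wedge hα hβ, sub_add_cancel]
  rw [h, hμ.integral_add (hα.wedge hβ).extD (hα.wedge hβ.extD), hμ.integral_extD (hα.wedge hβ),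
    zero_add]

namespace ContactMetricStructure

variable {M : ContactMetricStructure X} {A : DiffForm X 1} {σ : X → ℝ}

theorem action_eq_integral_ruminLift_wedge_extD (hA : IsSmoothForm A) :
    M.action A = integral M.vol (wedge (M.ruminLift A) (extD A)) := by
  have h : wedge (M.ruminLift A) (extD A) =
      wedge A (extD A) + smulForm (-M.verticalCurvature A) (wedge M.κ (extD A)) := by
    funext x
    simp only [wedge, ruminLift, smulForm, Pi.add_apply, wedgeOne_add_left, wedgeOne_smul_left]
  rw [h, M.isVolumeForm_vol.integral_add (hA.wedge hA.extD)
    ((M.smooth_κ.wedge hA.extD).smulForm (contMDiff_neg_verticalCurvature hA)), neg_smulForm,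
    integral_neg, ← sub_eq_add_neg]
  rfl

theorem action_add_smulForm_κ (hA : IsSmoothForm A) (hσ : ContMDiff (𝓡 3) 𝓘(ℝ, ℝ) ∞ σ) :
    M.action (A + smulForm σ M.κ) = M.action A := by
  have hAσ : IsSmoothForm (A + smulForm σ M.κ) := hA.add (M.smooth_κ.smulForm hσ)
  have hl := isSmoothForm_ruminLift (M := M) hA
  have h : wedge (A + smulForm σ M.κ) (extD (M.ruminLift A)) =
      wedge A (extD (M.ruminLift A)) := by
    funext x
    have hκ : wedgeOne (M.κ x) (extD (M.ruminLift A) x) = 0 :=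
      congrFun (wedge_κ_extD_ruminLift hA) x
    simp only [wedge, smulForm, Pi.add_apply, wedgeOne_add_left, wedgeOne_smul_left, hκ,
      smul_zero, add_zero]
  rw [action_eq_integral_ruminLift_wedge_extD hAσ, ruminLift_add_smulForm_κ hA hσ,
    M.isVolumeForm_vol.integral_wedge_extD_comm hl hAσ, h,
    M.isVolumeForm_vol.integral_wedge_extD_comm hA hl,
    action_eq_integral_ruminLift_wedge_extD hA]

theorem action_eq_integral_wedge_D (hA : IsSmoothForm A) (hH : M.IsHorizontal A) :
    M.action A = integral M.vol (wedge A (M.D A)) := by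
  rw [action_eq_integral_ruminLift_wedge_extD hA, D_eq_extD_ruminLift hA hH,
    M.isVolumeForm_vol.integral_wedge_extD_comm (isSmoothForm_ruminLift hA) hA]

variable (M A) in
theorem inner_star₂_D : M.inner A (M.star₂ (M.D A)) = integral M.vol (wedge A (M.D A)) := by
  rw [inner, D, star₁_star₂_wedge_κ]

theorem innerκ_neg_starH₁_D1 (hA : IsSmoothForm A) (hH : M.IsHorizontal A) :
    M.innerκ A (-M.starH₁ (M.D1 A)) = integral M.vol (wedge A (M.D A)) := by
  rw [innerκ, M.starH₁_neg_starH₁ (isHorizontal_D1 hA hH), ← integral_neg]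
  exact congrArg _ (funext fun x => (wedgeOne_left_anticomm _ _ _).symm)

end ContactMetricStructure

end Action

end ContactCS

end

open ContactCS in
theorem mainTheorem7 {X : Type*} [TopologicalSpace X] [ChartedSpace E3 X]
    [IsManifold (𝓡 3) ∞ X] [CompactSpace X] [T2Space X] (M : ContactMetricStructure X) :
    (∀ A : DiffForm X 1, IsSmoothForm A → ∀ σ : X → ℝ, ContMDiff (𝓡 3) 𝓘(ℝ, ℝ) ∞ σ →
      M.action (A + smulForm σ M.κ) = M.action A) ∧
    ∀ A : DiffForm X 1, IsSmoothForm A → M.IsHorizontal A →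
      M.action A = M.inner A (M.star₂ (M.D A)) ∧
      M.action A = M.innerκ A (-M.starH₁ (M.D1 A)) ∧
      (∃! l : DiffForm X 1, M.IsRuminLift A l) ∧
      ∀ l : DiffForm X 1, M.IsRuminLift A l → M.D A = extD l := by
  refine ⟨fun A hA σ hσ => M.action_add_smulForm_κ hA hσ, fun A hA hH => ?_⟩
  have hS : M.action A = integral M.vol (wedge A (M.D A)) :=
    M.action_eq_integral_wedge_D hA hH
  refine ⟨hS.trans (M.inner_star₂_D A).symm, hS.trans (M.innerκ_neg_starH₁_D1 hA hH).symm,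
    ⟨M.ruminLift A, M.isRuminLift_ruminLift A hA, fun l hl => hl.eq_ruminLift hA⟩,
    fun l hl => ?_⟩
  rw [hl.eq_ruminLift hA, M.D_eq_extD_ruminLift hA hH]
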